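/- Let $\mathsf k$ be an infinite field, let $d\ge 2$, and assume that $\operatorname{char}\mathsf k$ is $0$ or greater than $2d-2$. Let $T=(1,2,\dots,d-1,d,d-1,\dots,2,1)$. *Definitions.* Fill the Ferrers diagram of a partition $P=(p_1\ge p_2\ge\dots\ge p_s>0)$ by monomials, the $i$-th row from the top being $y^{i-1},y^{i-1}x,\dots,y^{i-1}x^{p_i-1}$. The partition $P$ has *diagonal lengths* $T$ if for every $m\ge 0$ the number of degree-$m$ monomials in this filling is $T_m$ (indices start at $0$, and $T_m=0$ for $m>2d-2$). A partition $P$ of diagonal lengths $T$ is *CIJT* (over $\mathsf k$) if there are a graded Artinian complete intersection $A=\mathsf k[x,y]/I$ (that is, $A\ne 0$ is finite-dimensional and $I$ is generated by two homogeneous polynomials) and a linear form $\ell\in A_1$ such that the sizes of the Jordan blocks of the nilpotent map $A\to A$, $a\mapsto \ell a$, are the parts of $P$. The Ferrers diagram of a partition $P$ of diagonal lengths $T$ contains all monomials of degree at most $d-1$ (the basic triangle $\Delta_d$). Let $e$ be the largest $i\in\{0,\dots,d\}$ such that $x^iy^{d-i}$ is not in the filling of $P$. The *branch label* of $P$ is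 the sequence $\mathfrak b=(\mathfrak b(0),\dots,\mathfrak b(d))$ with $\mathfrak b(e)=0$; with $\mathfrak b(i)=[\text{length of the }(i+1)\text{-st column of }P]-(d-i)$ for $i<e$; and with $\mathfrak b(i)=[\text{length of the }(i-e)\text{-th row of }P]-(d-i+e+1)$ for $i>e$. **Theorem.** A partition $P$ of diagonal lengths $T$ is CIJT if and only if there exist an integer $1\le v\le d$, an integer $c\ge 0$ and an increasing sequence $0=a_0<a_1<\dots<a_c=d-v$ such that the branch label of $P$ is $$\mathfrak b=(0,\mathfrak v,0,\mathfrak h_1,\dots,\mathfrak h_c),$$ where $\mathfrak v$ is the (possibly empty) interval $\{x\in\mathbb Z\mid 1\le x<v\}$, $\mathfrak h_i$ is the interval $\{x\in\mathbb Z\mid d-a_i\le x<d-a_{i-1}\}$ for $i=1,\dots,c$, and every interval is listed in increasing order. -/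

import Mathlib

namespace HeightTwoCI

/-- `φ` has Jordan type `P`, for a nilpotent endomorphism `φ`: the space has a basis made of strings,
one string `b (i, 0), φ (b (i, 0)) = b (i, 1), …` of length `P.rowLen i` for each row (part) `i` of `P`,
and `φ` kills the last vector of each string. The basis vectors are indexed by the boxes
(row, column) of the Ferrers diagram of `P`. -/
def IsJordanType {k V : Type*} [Field k] [AddCommGroup V] [Module k V]
    (φ : Module.End k V) (P : YoungDiagram) : Prop :=
  ∃ b : Module.Basis P.cells k V, ∀ c : P.cells,
    φ (b c) = if h : (c.1.1, c.1.2 + 1) ∈ P.cells then b ⟨(c.1.1, c.1.2 + 1), h⟩ else 0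

/-- `k[x,y]/I` is a graded Artinian complete intersection of height two: it is a nonzero
finite-dimensional algebra, and the ideal `I` is generated by two homogeneous polynomials. -/
def IsGradedCI {k : Type*} [Field k] (I : Ideal (MvPolynomial (Fin 2) k)) : Prop :=
  I ≠ ⊤ ∧ Module.Finite k (MvPolynomial (Fin 2) k ⧸ I) ∧
    ∃ (f g : MvPolynomial (Fin 2) k) (m n : ℕ),
      f.IsHomogeneous m ∧ g.IsHomogeneous n ∧ I = Ideal.span {f, g}

/-- `P` is a complete intersection Jordan type over `k`: it is the Jordan type of the multiplication
by (the class of) some linear form on some graded complete intersection quotient of `k[x,y]`. -/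
def IsCIJT (k : Type*) [Field k] (P : YoungDiagram) : Prop :=
  ∃ I : Ideal (MvPolynomial (Fin 2) k), IsGradedCI I ∧
    ∃ l : MvPolynomial (Fin 2) k, l.IsHomogeneous 1 ∧
      IsJordanType (LinearMap.mulLeft k (Ideal.Quotient.mk I l)) P

/-- The sequence `(1, 2, …, d-1, d, d-1, …, 2, 1, 0, 0, …)`, indexed from degree `0`
(the subtraction is truncated). -/
def peak (d m : ℕ) : ℕ := min (m + 1) (2 * d - 1 - m)

/-- `P` has diagonal lengths `T`: the box in row `i` and column `j` (counted from `0`) carries the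
monomial `y ^ i * x ^ j`, and `T m` is the number of boxes whose monomial has degree `m`. -/
def HasDiagonalLengths (P : YoungDiagram) (T : ℕ → ℕ) : Prop :=
  ∀ m : ℕ, (P.cells.filter fun c => c.1 + c.2 = m).card = T m

/-- The largest `i ≤ d` with a gap at the position of `x ^ i * y ^ (d - i)`. -/
def lastGap (d : ℕ) (P : YoungDiagram) : ℕ :=
  Nat.findGreatest (fun i => (d - i, i) ∉ P) d

/-- The branch label `(𝔟(0), …, 𝔟(d))` of a partition `P` with diagonal lengths `peak d`. With
`e = lastGap d P` it lists, from left to right, the lengths of the branches attached below the first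
`e` columns of the basic triangle (column `i`, counted from `0`, of the triangle has length `d - i`),
then `0`, then, from top to bottom, the lengths of the branches attached to the first `d - e` rows
(row `r`, counted from `0`, of the triangle has length `d - r`, and `i = e + 1 + r`). -/
def branchLabel (d : ℕ) (P : YoungDiagram) : List ℕ :=
  (List.range (d + 1)).map fun i =>
    if i < lastGap d P then P.colLen i - (d - i)
    else if i = lastGap d P then 0
    else P.rowLen (i - lastGap d P - 1) - (d - (i - lastGap d P - 1))

end HeightTwoCI

/-! Both conditions are equivalent to `IsBlockDiagram`: for some 0 = b 0 < ... < b n = d, the rows r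
with b k ≤ r < b (k + 1) all have length 2d - b k - b (k + 1).

Necessity. A linear change of variables turns ℓ into `X 1`. Let p i be the least exponent such that
`X 1 ^ p i` kills, modulo I, the homogenization of some monic polynomial W i of degree i. The
multiples of these forms by powers of `X 1` are Jordan strings, so the p i are the row lengths
(`IsStringSystem.rowLen_eq`). Macaulay duality describes I by one functional
(`exists_dual_functional`), and the resulting pairing makes i ↦ D - i - p i a length-preserving
involution of the nonempty rows (`IsStringSystem.symmetric`). The diagonal lengths force D = 2d - 1
and exactly d rows, and a nonincreasing sequence with this symmetry splits into blocks
(`isBlockDiagram_of_symmetric`).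

Sufficiency. Let Q k, of degree b k, be the denominators of the continued fraction with partial
quotients X ^ (b (k + 1) - b k). Homogenizing Q n and Q (n - 1) in degree d gives a complete
intersection. The polynomials X ^ (i - b k) * Q k start its strings, and the recurrence identifies
the ideal with the span of the string vectors outside P (`isCIJT_of_isBlockDiagram`).

Combinatorics. With n = c + 1 and v = d - b c, the last block is a v × v square. It locates the last
gap and yields the vertical branches; the earlier blocks yield the horizontal ones
(`isBlockDiagram_iff_branchLabel`). -/

namespace HeightTwoCI

open Polynomial

/-! ### String bases of k[x,y] for multiplication by `X 1` -/

section Strings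

variable {k : Type*} [Field k]

/-- The homogeneous polynomial of degree `q.1 + q.2` obtained by homogenizing `W q.1`. -/
noncomputable def stringVec (W : ℕ → k[X]) (q : ℕ × ℕ) : MvPolynomial (Fin 2) k :=
  (W q.1).homogenize (q.1 + q.2)

theorem X_one_mul_homogenize (p : k[X]) (n : ℕ) (hp : p.natDegree ≤ n) :
    MvPolynomial.X 1 * p.homogenize n = p.homogenize (n + 1) := by
  have := homogenize_mul (1 : k[X]) p (m := 1) (n := n) (by simp) hp
  rw [one_mul, add_comm] at this
  rw [this]; simp

theorem X_zero_mul_homogenize (p : k[X]) (n : ℕ) (hp : p.natDegree ≤ n) :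
    MvPolynomial.X 0 * p.homogenize n = (X * p).homogenize (n + 1) := by
  have := homogenize_mul (X : k[X]) p (m := 1) (n := n) (by simp) hp
  rw [add_comm] at this
  rw [this]; simp

theorem X_one_pow_mul_homogenize (p : k[X]) (n a : ℕ) (hp : p.natDegree ≤ n) :
    MvPolynomial.X 1 ^ a * p.homogenize n = p.homogenize (n + a) := by
  have := homogenize_mul (1 : k[X]) p (m := a) (n := n) (by simp) hp
  rw [one_mul, add_comm] at this
  rw [this]; simp

theorem X_zero_pow_mul_homogenize (p : k[X]) (n a : ℕ) (hp : p.natDegree ≤ n) :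
    MvPolynomial.X 0 ^ a * p.homogenize n = (X ^ a * p).homogenize (n + a) := by
  have := homogenize_mul (X ^ a : k[X]) p (m := a) (n := n) (by simp) hp
  rw [add_comm] at this
  rw [this]; simp

/-- Triangularity: among the indices in a relation choose q with q.1 maximal. The monomial `X 0 ^
q.1 * X 1 ^ q.2` then occurs in no other vector of the relation, and in q's vector with coefficient
1. -/
theorem linearIndependent_stringVec {W : ℕ → k[X]} (hW : ∀ i, (W i).Monic)
    (hdeg : ∀ i, (W i).natDegree = i) : LinearIndependent k (stringVec W) := by
  rw [linearIndependent_iff]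
  intro l hl
  by_contra hne
  obtain ⟨q, hq, hmax⟩ := Finset.exists_max_image l.support Prod.fst
    (Finsupp.support_nonempty_iff.2 hne)
  let m : Fin 2 →₀ ℕ := fun₀ | 0 => q.1 | 1 => q.2
  have hm0 : m 0 = q.1 := by simp [m]
  have hm1 : m 1 = q.2 := by simp [m]
  have h := congrArg (MvPolynomial.coeff m) hl
  rw [Finsupp.linearCombination_apply, Finsupp.sum, MvPolynomial.coeff_sum,
    Finset.sum_eq_single q] at h
  · rw [MvPolynomial.coeff_smul, stringVec, coeff_homogenize, hm0, hm1, if_pos rfl] at h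
    have h1 : (W q.1).coeff q.1 = 1 := by
      have := (hW q.1).coeff_natDegree
      rwa [hdeg] at this
    rw [h1] at h
    simp at h
    exact (Finsupp.mem_support_iff.1 hq) h
  · intro q' hq' hqq
    rw [MvPolynomial.coeff_smul, stringVec, coeff_homogenize, hm0, hm1]
    split_ifs with hs
    · have hle := hmax q' hq'
      have hlt : q'.1 < q.1 := by
        rcases hle.lt_or_eq with h' | h'
        · exact h'
        · exact absurd (Prod.ext h' (by omega)) hqq
      rw [coeff_eq_zero_of_natDegree_lt (by rw [hdeg]; exact hlt), smul_zero]
    · simp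
  · intro h'; exact absurd hq h'

theorem degree_sub_coeff_smul_lt {U V : k[X]} {i : ℕ} (hU : U.natDegree ≤ i) (hV : V.Monic)
    (hVd : V.natDegree = i) : (U - U.coeff i • V).degree < i := by
  rw [degree_lt_iff_coeff_zero]
  intro m hm
  rcases hm.lt_or_eq with h | h
  · rw [coeff_sub, coeff_smul, coeff_eq_zero_of_natDegree_lt (hU.trans_lt h),
      coeff_eq_zero_of_natDegree_lt (hVd.trans_lt h)]
    simp
  · have := hV.coeff_natDegree
    rw [hVd] at this
    subst h
    simp [this]

theorem homogenize_mem_span {W : ℕ → k[X]} (hW : ∀ i, (W i).Monic)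
    (hdeg : ∀ i, (W i).natDegree = i) (i : ℕ) : ∀ (p : k[X]) (t : ℕ), p.degree < i → i ≤ t + 1 →
      p.homogenize t ∈ Submodule.span k (stringVec W '' {q | q.1 + q.2 = t ∧ q.1 < i}) := by
  induction i with
  | zero => intro p t hp _; simp at hp; simp [hp]
  | succ i ih =>
    intro p t hp hit
    have h1 : (p - p.coeff i • W i).degree < i :=
      degree_sub_coeff_smul_lt (natDegree_le_iff_degree_le.2 (Order.lt_succ_iff.1 hp))
        (hW i) (hdeg i)
    have h2 := ih _ t h1 (by omega)
    have h3 : stringVec W (i, t - i) ∈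
        Submodule.span k (stringVec W '' {q | q.1 + q.2 = t ∧ q.1 < i + 1}) :=
      Submodule.subset_span ⟨(i, t - i), ⟨by simp; omega, by simp⟩, rfl⟩
    have h4 : p.homogenize t = (p - p.coeff i • W i).homogenize t
        + p.coeff i • stringVec W (i, t - i) := by
      rw [stringVec, homogenize_sub, homogenize_smul, show i + (t - i) = t by omega]
      simp
    rw [h4]
    refine add_mem (Submodule.span_mono ?_ h2) (Submodule.smul_mem _ _ h3)
    exact Set.image_mono fun q hq => ⟨hq.1, hq.2.trans (Nat.lt_succ_self i)⟩

theorem homogeneous_eq_homogenize {u : MvPolynomial (Fin 2) k} {t : ℕ} (hu : u.IsHomogeneous t) :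
    ∃ p : k[X], p.natDegree ≤ t ∧ u = p.homogenize t := by
  have h := homogenize_eq_of_isHomogeneous hu rfl
  refine ⟨MvPolynomial.aeval ![X, 1] u, ?_, h.symm⟩
  rw [MvPolynomial.aeval_def, MvPolynomial.eval₂_eq']
  refine natDegree_sum_le_of_forall_le _ _ fun m hm => ?_
  have hd := hu.degree_eq_sum_deg_support hm
  have h01 : m 0 + m 1 = t := by
    rw [hd, ← Finsupp.degree_apply, Finsupp.degree_eq_sum, Fin.sum_univ_two]
  simp only [Fin.prod_univ_two, Matrix.cons_val_zero, Matrix.cons_val_one, one_pow, mul_one]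
  refine (natDegree_C_mul_X_pow_le _ _).trans (by omega)

theorem homogeneous_mem_span {W : ℕ → k[X]} (hW : ∀ i, (W i).Monic)
    (hdeg : ∀ i, (W i).natDegree = i) {u : MvPolynomial (Fin 2) k} {t : ℕ}
    (hu : u.IsHomogeneous t) :
    u ∈ Submodule.span k (stringVec W '' {q | q.1 + q.2 = t}) := by
  obtain ⟨p, hp, rfl⟩ := homogeneous_eq_homogenize hu
  refine Submodule.span_mono ?_ (homogenize_mem_span hW hdeg (t + 1) p t ?_ le_rfl)
  · exact Set.image_mono fun q hq => hq.1
  · exact lt_of_le_of_lt degree_le_natDegree (by exact_mod_cast Nat.lt_succ_of_le hp)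

theorem span_stringVec {W : ℕ → k[X]} (hW : ∀ i, (W i).Monic)
    (hdeg : ∀ i, (W i).natDegree = i) : Submodule.span k (Set.range (stringVec W)) = ⊤ := by
  rw [eq_top_iff]
  intro u _
  rw [← u.sum_homogeneousComponent]
  refine Submodule.sum_mem _ fun t _ => ?_
  exact Submodule.span_mono (Set.image_subset_range _ _)
    (homogeneous_mem_span hW hdeg (MvPolynomial.homogeneousComponent_isHomogeneous t u))

/-- The string vectors form a basis of the polynomial ring on which `X 1` acts by (i, c) ↦ (i, c +
1). Dividing out those outside P leaves a Jordan basis indexed by the boxes of P. -/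
theorem isJordanType_of_eq_span {W : ℕ → k[X]} (hW : ∀ i, (W i).Monic)
    (hdeg : ∀ i, (W i).natDegree = i) (I : Ideal (MvPolynomial (Fin 2) k)) (P : YoungDiagram)
    (hI : I.restrictScalars k = Submodule.span k (stringVec W '' {q | q ∉ P})) :
    IsJordanType (LinearMap.mulLeft k (Ideal.Quotient.mk I (MvPolynomial.X 1))) P := by
  let f : MvPolynomial (Fin 2) k →ₗ[k] MvPolynomial (Fin 2) k ⧸ I :=
    (Ideal.Quotient.mkₐ k I).toLinearMap
  have hker : LinearMap.ker f = I.restrictScalars k := by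
    ext u
    simp [f, Ideal.Quotient.eq_zero_iff_mem]
  have hmem : ∀ q, q ∉ P → f (stringVec W q) = 0 := by
    intro q hq
    rw [← LinearMap.mem_ker, hker, hI]
    exact Submodule.subset_span ⟨q, hq, rfl⟩
  have hLI : LinearIndependent k (fun c : P.cells => f (stringVec W c.1)) := by
    have h0 := linearIndependent_stringVec hW hdeg
    have h1 : LinearIndependent k (fun c : P.cells => stringVec W c.1) :=
      h0.comp _ Subtype.val_injective
    refine h1.map ?_
    rw [hker, hI]
    have : Set.range (fun c : P.cells => stringVec W c.1) = stringVec W '' {q | q ∈ P} := by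
      ext u; simp
    rw [this]
    refine h0.disjoint_span_image ?_
    rw [Set.disjoint_left]
    intro q h h'; exact h' h
  have hsp : ⊤ ≤ Submodule.span k (Set.range (fun c : P.cells => f (stringVec W c.1))) := by
    have hsurj : Function.Surjective f := Ideal.Quotient.mk_surjective
    rw [← LinearMap.range_eq_top.2 hsurj, LinearMap.range_eq_map, ← span_stringVec hW hdeg,
      Submodule.map_span, Submodule.span_le]
    rintro _ ⟨_, ⟨q, rfl⟩, rfl⟩
    by_cases hq : q ∈ P
    · exact Submodule.subset_span ⟨⟨q, hq⟩, rfl⟩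
    · rw [hmem q hq]; exact zero_mem _
  refine ⟨Module.Basis.mk hLI hsp, fun c => ?_⟩
  have hmul : LinearMap.mulLeft k (Ideal.Quotient.mk I (MvPolynomial.X 1)) (f (stringVec W c.1))
      = f (stringVec W (c.1.1, c.1.2 + 1)) := by
    change Ideal.Quotient.mk I (MvPolynomial.X 1) * Ideal.Quotient.mk I _
      = Ideal.Quotient.mk I _
    rw [← map_mul, stringVec, X_one_mul_homogenize _ _ (by rw [hdeg]; omega)]
    rfl
  rw [Module.Basis.mk_apply, hmul]
  split_ifs with h
  · rw [Module.Basis.mk_apply]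
  · exact hmem _ h

end Strings

/-! ### Uniqueness of the Jordan type -/

section JordanUniqueness

variable {k V : Type*} [Field k] [AddCommGroup V] [Module k V] {φ : Module.End k V}

theorem pow_apply_string {P : YoungDiagram} (b : Module.Basis P.cells k V)
    (hb : ∀ c : P.cells,
      φ (b c) = if h : (c.1.1, c.1.2 + 1) ∈ P.cells then b ⟨(c.1.1, c.1.2 + 1), h⟩ else 0)
    (a : ℕ) (c : P.cells) :
    (φ ^ a) (b c) = if h : (c.1.1, c.1.2 + a) ∈ P.cells then b ⟨(c.1.1, c.1.2 + a), h⟩ else 0 := by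
  induction a with
  | zero => simp
  | succ a ih =>
    rw [pow_succ', Module.End.mul_apply, ih]
    by_cases h : (c.1.1, c.1.2 + a) ∈ P.cells
    · rw [dif_pos h, hb]
      rfl
    · rw [dif_neg h, map_zero, dif_neg]
      intro h'
      exact h (P.up_left_mem le_rfl (by omega) h')

theorem IsJordanType.finrank_range_pow {P : YoungDiagram} (h : IsJordanType φ P) (a : ℕ) :
    Module.finrank k (LinearMap.range (φ ^ a)) = (P.cells.filter fun c => a ≤ c.2).card := by
  obtain ⟨b, hb⟩ := h
  have hp := pow_apply_string b hb a
  let S := P.cells.filter fun c => a ≤ c.2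
  have hS : ∀ c : S, c.1 ∈ P.cells := fun c => (Finset.mem_filter.1 c.2).1
  let w : S → V := fun c => b ⟨c.1, hS c⟩
  have hw : LinearIndependent k w := by
    refine b.linearIndependent.comp (fun c : S => ⟨c.1, hS c⟩) ?_
    intro c c' hcc
    exact Subtype.ext (congrArg (fun z : P.cells => z.1) hcc)
  have hr : LinearMap.range (φ ^ a) = Submodule.span k (Set.range w) := by
    apply le_antisymm
    · rw [LinearMap.range_eq_map, ← b.span_eq, Submodule.map_span, Submodule.span_le]
      rintro _ ⟨_, ⟨c, rfl⟩, rfl⟩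
      rw [hp]
      split_ifs with h
      · exact Submodule.subset_span ⟨⟨_, Finset.mem_filter.2 ⟨h, by simp⟩⟩, rfl⟩
      · exact zero_mem _
    · rw [Submodule.span_le]
      rintro _ ⟨c, rfl⟩
      have hc := Finset.mem_filter.1 c.2
      have hc' : (c.1.1, c.1.2 - a) ∈ P.cells := P.up_left_mem le_rfl (Nat.sub_le _ _) hc.1
      refine ⟨b ⟨_, hc'⟩, ?_⟩
      have he : ((c.1.1, c.1.2 - a + a) : ℕ × ℕ) = c.1 := by
        rw [Nat.sub_add_cancel hc.2]
      rw [hp, dif_pos (by simp only [he]; exact hc.1)]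
      simp only [he, w]
  rw [hr, finrank_span_eq_card hw, Fintype.card_coe]

/-- Column a has length rank φ^a - rank φ^(a+1), so the columns depend on φ alone. -/
theorem IsJordanType.unique {P Q : YoungDiagram} (hP : IsJordanType φ P)
    (hQ : IsJordanType φ Q) : P = Q := by
  have key : ∀ (R : YoungDiagram) (a : ℕ), R.colLen a + (R.cells.filter fun c => a + 1 ≤ c.2).card
      = (R.cells.filter fun c => a ≤ c.2).card := by
    intro R a
    rw [YoungDiagram.colLen_eq_card, YoungDiagram.col, ← Finset.card_union_of_disjoint]
    · congr 1
      ext c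
      simp only [Finset.mem_union, Finset.mem_filter, ← and_or_left]
      refine and_congr_right fun _ => ?_
      omega
    · rw [Finset.disjoint_left]
      intro c h h'
      have := (Finset.mem_filter.1 h).2
      have := (Finset.mem_filter.1 h').2
      omega
  have hcol : ∀ a, P.colLen a = Q.colLen a := by
    intro a
    have h1 := key P a
    have h2 := key Q a
    rw [← hP.finrank_range_pow, ← hP.finrank_range_pow] at h1
    rw [← hQ.finrank_range_pow, ← hQ.finrank_range_pow] at h2
    omega
  ext ⟨i, j⟩
  rw [YoungDiagram.mem_cells, YoungDiagram.mem_cells, YoungDiagram.mem_iff_lt_colLen,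
    YoungDiagram.mem_iff_lt_colLen, hcol]

end JordanUniqueness

/-! ### Block sequences and block diagrams -/

/-- `0 = b 0 < b 1 < ⋯ < b n = d`, continued by the constant `d`. -/
structure IsBlockSeq (d n : ℕ) (b : ℕ → ℕ) : Prop where
  pos : 1 ≤ n
  zero : b 0 = 0
  lt_succ : ∀ k < n, b k < b (k + 1)
  eq_top : ∀ k, n ≤ k → b k = d

/-- The rows of `P` are grouped in blocks `b k ≤ r < b (k + 1)` of rows of equal length
`2 * d - b k - b (k + 1)`. -/
def IsBlockDiagram (d : ℕ) (P : YoungDiagram) : Prop :=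
  ∃ (n : ℕ) (b : ℕ → ℕ), IsBlockSeq d n b ∧
    (∀ k r, b k ≤ r → r < b (k + 1) → P.rowLen r = 2 * d - b k - b (k + 1)) ∧
    ∀ r, d ≤ r → P.rowLen r = 0

namespace IsBlockSeq

variable {d n : ℕ} {b : ℕ → ℕ}

theorem monotone (h : IsBlockSeq d n b) : Monotone b := by
  refine monotone_nat_of_le_succ fun k => ?_
  rcases lt_or_ge k n with hk | hk
  · exact (h.lt_succ k hk).le
  · rw [h.eq_top k hk, h.eq_top (k + 1) (by omega)]

theorem le_top (h : IsBlockSeq d n b) (k : ℕ) : b k ≤ d := by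
  rw [← h.eq_top (max k n) (le_max_right _ _)]
  exact h.monotone (le_max_left _ _)

end IsBlockSeq

/-- The index of the block containing row `i`. -/
def blockIndex (n : ℕ) (b : ℕ → ℕ) (i : ℕ) : ℕ :=
  Nat.findGreatest (fun k => b k ≤ i) n

section BlockIndex

variable {d n : ℕ} {b : ℕ → ℕ}

theorem blockIndex_le (h : IsBlockSeq d n b) (i : ℕ) : b (blockIndex n b i) ≤ i :=
  Nat.findGreatest_spec (P := fun k => b k ≤ i) (Nat.zero_le n) (by simp [h.zero])

theorem lt_blockIndex_succ {i : ℕ} (hi : blockIndex n b i < n) :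
    i < b (blockIndex n b i + 1) := by
  by_contra hc
  exact Nat.findGreatest_is_greatest (P := fun k => b k ≤ i) (Nat.lt_succ_self _) hi
    (not_lt.1 hc)

theorem blockIndex_eq (h : IsBlockSeq d n b) {i k : ℕ} (hk : k ≤ n) (h1 : b k ≤ i) (h2 : k < n → i < b (k + 1)) :
    blockIndex n b i = k := by
  apply le_antisymm
  · by_contra hc
    have h3 : blockIndex n b i ≤ n := Nat.findGreatest_le n
    have h4 := blockIndex_le h i
    have h5 := h.monotone (show k + 1 ≤ blockIndex n b i by omega)
    have h6 := h2 (by omega)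
    omega
  · exact Nat.le_findGreatest hk h1

end BlockIndex

/-! ### A complete intersection with a given block diagram -/

section Construction

variable {k : Type*} [Field k]

/-- The denominators of the continued fraction with partial quotients `X ^ (b (i + 1) - b i)`. -/
noncomputable def blockPoly (k : Type*) [Field k] (b : ℕ → ℕ) : ℕ → k[X]
  | 0 => 1
  | 1 => X ^ b 1
  | i + 2 => X ^ (b (i + 2) - b (i + 1)) * blockPoly k b (i + 1) + blockPoly k b i

/-- The monic polynomial of degree `i` obtained by multiplying the `blockPoly` of the block of `i`
by a power of `X`. -/
noncomputable def rowPoly (k : Type*) [Field k] (n : ℕ) (b : ℕ → ℕ) (i : ℕ) : k[X] :=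
  X ^ (i - b (blockIndex n b i)) * blockPoly k b (blockIndex n b i)

variable {d n : ℕ} {b : ℕ → ℕ}

theorem blockPoly_monic_natDegree (h : IsBlockSeq d n b) :
    ∀ i ≤ n, (blockPoly k b i).Monic ∧ (blockPoly k b i).natDegree = b i
  | 0, _ => by simp [blockPoly, h.zero, monic_one]
  | 1, _ => by simp [blockPoly, monic_X_pow]
  | i + 2, hi => by
    obtain ⟨m1, d1⟩ := blockPoly_monic_natDegree h (i + 1) (by omega)
    obtain ⟨m0, d0⟩ := blockPoly_monic_natDegree h i (by omega)
    have hm : (X ^ (b (i + 2) - b (i + 1)) * blockPoly k b (i + 1)).Monic :=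
      (monic_X_pow _).mul m1
    have l1 := h.lt_succ i (by omega)
    have l2 : b (i + 1) < b (i + 2) := h.lt_succ (i + 1) (by omega)
    have hd : (X ^ (b (i + 2) - b (i + 1)) * blockPoly k b (i + 1)).natDegree = b (i + 2) := by
      rw [(monic_X_pow _).natDegree_mul m1, natDegree_X_pow, d1]
      omega
    have hlt : (blockPoly k b i).natDegree
        < (X ^ (b (i + 2) - b (i + 1)) * blockPoly k b (i + 1)).natDegree := by
      rw [hd, d0]; omega
    rw [blockPoly]
    exact ⟨hm.add_of_left (degree_lt_degree hlt), by
      rw [natDegree_add_eq_left_of_natDegree_lt hlt, hd]⟩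

theorem rowPoly_monic (h : IsBlockSeq d n b) (i : ℕ) : (rowPoly k n b i).Monic :=
  (monic_X_pow _).mul (blockPoly_monic_natDegree h _ (Nat.findGreatest_le n)).1

theorem rowPoly_natDegree (h : IsBlockSeq d n b) (i : ℕ) : (rowPoly k n b i).natDegree = i := by
  have hQ := blockPoly_monic_natDegree (k := k) h (blockIndex n b i) (Nat.findGreatest_le n)
  rw [rowPoly, (monic_X_pow _).natDegree_mul hQ.1, natDegree_X_pow]
  have := blockIndex_le h i
  omega

theorem rowPoly_block (h : IsBlockSeq d n b) {i : ℕ} (hi : i ≤ n) :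
    rowPoly k n b (b i) = blockPoly k b i := by
  rw [rowPoly, blockIndex_eq h hi le_rfl (h.lt_succ i)]
  simp

/-- Inside a block, and beyond the last one, X only raises the power. At the end of a block the
recurrence for `blockPoly` introduces a correction from two blocks back, except for the first block,
where there is none. -/
theorem X_mul_rowPoly (h : IsBlockSeq d n b) (i : ℕ) :
    X * rowPoly k n b i = rowPoly k n b (i + 1) ∨
      ∃ j, j + 2 ≤ n ∧ b (j + 1) ≤ i ∧ i + 1 = b (j + 2) ∧
        X * rowPoly k n b i = rowPoly k n b (i + 1) - rowPoly k n b (b j) := by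
  have hle := blockIndex_le h i
  have hn : blockIndex n b i ≤ n := Nat.findGreatest_le n
  by_cases hlast : blockIndex n b i < n ∧ i + 1 = b (blockIndex n b i + 1)
  · obtain ⟨hlt, hi⟩ := hlast
    have hnext : rowPoly k n b (i + 1) = blockPoly k b (blockIndex n b i + 1) := by
      rw [hi, rowPoly_block h hlt]
    rcases Nat.eq_zero_or_pos (blockIndex n b i) with h0 | h0
    · left
      rw [hnext, rowPoly, h0, h.zero, zero_add, blockPoly, blockPoly]
      rw [h0, zero_add] at hi
      rw [← hi, pow_succ', Nat.sub_zero, mul_one]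
    · right
      obtain ⟨j, hj⟩ : ∃ j, blockIndex n b i = j + 1 := ⟨_, (Nat.succ_pred h0.ne').symm⟩
      rw [hj] at hlt hi hnext hle
      replace hi : i + 1 = b (j + 2) := hi
      refine ⟨j, hlt, hle, hi, ?_⟩
      rw [hnext, rowPoly_block h (by omega), rowPoly, hj, blockPoly, add_sub_cancel_right,
        ← mul_assoc, ← pow_succ']
      congr 2
      omega
  · left
    have hne : blockIndex n b (i + 1) = blockIndex n b i := by
      refine blockIndex_eq h hn (by omega) fun hlt => ?_
      have := lt_blockIndex_succ hlt
      have : i + 1 ≠ b (blockIndex n b i + 1) := fun he => hlast ⟨hlt, he⟩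
      omega
    rw [rowPoly, rowPoly, hne, ← mul_assoc, ← pow_succ']
    congr 2
    omega

/-- The complete intersection ideal attached to a block sequence. -/
noncomputable def blockIdeal (k : Type*) [Field k] (d n : ℕ) (b : ℕ → ℕ) :
    Ideal (MvPolynomial (Fin 2) k) :=
  Ideal.span {(blockPoly k b n).homogenize d, (blockPoly k b (n - 1)).homogenize d}

/-- The recurrence is run backwards from the two generators: Q j = Q (j + 2) - X ^ (b (j + 2) - b (j
+ 1)) * Q (j + 1), homogenized in degree 2d - b (j + 1). Since b is constantly d from n on, the base
cases m = 0, 1 both lie in degree d. -/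
theorem homogenize_blockPoly_mem (h : IsBlockSeq d n b) (m : ℕ) (hm : m ≤ n) :
    (blockPoly k b (n - m)).homogenize (2 * d - b (n - m + 1)) ∈ blockIdeal k d n b := by
  have hpos := h.pos
  induction m using Nat.strong_induction_on with
  | _ m ih =>
  match m, hm, ih with
  | 0, _, _ =>
    rw [h.eq_top _ (by omega), show 2 * d - d = d by omega]
    exact Ideal.subset_span (by simp)
  | 1, _, _ =>
    rw [h.eq_top _ (by omega), show 2 * d - d = d by omega]
    exact Ideal.subset_span (by simp)
  | m + 2, hm, ih =>
    obtain ⟨j, hj⟩ : ∃ j, n - (m + 2) = j := ⟨_, rfl⟩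
    have i1 := ih (m + 1) (by omega) (by omega)
    have i2 := ih m (by omega) (by omega)
    rw [show n - (m + 1) = j + 1 by omega] at i1
    rw [show n - m = j + 2 by omega] at i2
    rw [hj]
    have l0 : b (j + 1) < b (j + 2) := h.lt_succ (j + 1) (by omega)
    have l1 := h.le_top (j + 2)
    have l2 := h.monotone (show j + 2 ≤ j + 3 by omega)
    have l3 := h.le_top (j + 3)
    have d1 := (blockPoly_monic_natDegree (k := k) h (j + 1) (by omega)).2
    have d2 := (blockPoly_monic_natDegree (k := k) h (j + 2) (by omega)).2
    have e : blockPoly k b j = blockPoly k b (j + 2)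
        - X ^ (b (j + 2) - b (j + 1)) * blockPoly k b (j + 1) := by
      rw [blockPoly]; ring
    have e2 := X_zero_pow_mul_homogenize (blockPoly k b (j + 1)) (2 * d - b (j + 1 + 1))
      (b (j + 2) - b (j + 1)) (by rw [d1, show j + 1 + 1 = j + 2 from rfl]; omega)
    have e3 := X_one_pow_mul_homogenize (blockPoly k b (j + 2)) (2 * d - b (j + 2 + 1))
      (b (j + 3) - b (j + 1)) (by rw [d2, show j + 2 + 1 = j + 3 from rfl]; omega)
    rw [show 2 * d - b (j + 1 + 1) + (b (j + 2) - b (j + 1)) = 2 * d - b (j + 1) by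
      rw [show j + 1 + 1 = j + 2 from rfl]; omega] at e2
    rw [show 2 * d - b (j + 2 + 1) + (b (j + 3) - b (j + 1)) = 2 * d - b (j + 1) by
      rw [show j + 2 + 1 = j + 3 from rfl]; omega] at e3
    rw [e, homogenize_sub, ← e2, ← e3]
    exact sub_mem (Ideal.mul_mem_left _ _ i2) (Ideal.mul_mem_left _ _ i1)

theorem span_le_ideal_of_mul_X_mem {N : Submodule k (MvPolynomial (Fin 2) k)}
    (hN : ∀ i, ∀ u ∈ N, MvPolynomial.X i * u ∈ N) {S : Set (MvPolynomial (Fin 2) k)}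
    (hS : S ⊆ N) : (Ideal.span S).restrictScalars k ≤ N := by
  have hmul : ∀ r u, u ∈ N → r * u ∈ N := by
    intro r
    induction r using MvPolynomial.induction_on with
    | C a => intro u hu; rw [MvPolynomial.C_mul']; exact N.smul_mem a hu
    | add p q hp hq => intro u hu; rw [add_mul]; exact add_mem (hp u hu) (hq u hu)
    | mul_X p i hp => intro u hu; rw [mul_assoc]; exact hp _ (hN i u hu)
  intro u hu
  refine Submodule.span_induction (p := fun x _ => x ∈ N) (fun x hx => hS hx) (zero_mem _)
    (fun x y _ _ => add_mem) (fun r x _ hx => hmul r x hx) hu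

theorem isCIJT_of_isBlockDiagram (k : Type*) [Field k] {P : YoungDiagram}
    (hd : 1 ≤ d) (hP : IsBlockDiagram d P) : IsCIJT k P := by
  obtain ⟨n, b, h, hrow, hrow0⟩ := hP
  have hW := rowPoly_monic (k := k) h
  have hdeg := rowPoly_natDegree (k := k) h
  have hpos := h.pos
  have hnotmem : ∀ i c, (i, c) ∉ P ↔ P.rowLen i ≤ c := fun i c => by
    rw [YoungDiagram.mem_iff_lt_rowLen, not_lt]
  have hrowi : ∀ i, P.rowLen i = 2 * d - b (blockIndex n b i) - b (blockIndex n b i + 1) := by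
    intro i
    have hle := blockIndex_le h i
    have hn : blockIndex n b i ≤ n := Nat.findGreatest_le n
    rcases hn.lt_or_eq with hlt | heq
    · exact hrow _ _ hle (lt_blockIndex_succ hlt)
    · rw [heq, h.eq_top n le_rfl] at hle
      rw [hrow0 i hle, heq, h.eq_top n le_rfl, h.eq_top (n + 1) (by omega)]
      omega
  let N : Submodule k (MvPolynomial (Fin 2) k) :=
    Submodule.span k (stringVec (rowPoly k n b) '' {q | q ∉ P})
  have hNmem : ∀ i c, P.rowLen i ≤ c → stringVec (rowPoly k n b) (i, c) ∈ N := fun i c hic =>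
    Submodule.subset_span ⟨(i, c), (hnotmem i c).2 hic, rfl⟩
  have hX : ∀ i, ∀ u ∈ N, MvPolynomial.X i * u ∈ N := by
    intro i u hu
    refine Submodule.span_induction (p := fun x _ => MvPolynomial.X i * x ∈ N) ?_ (by simp)
      (fun x y _ _ hx hy => by rw [mul_add]; exact add_mem hx hy)
      (fun a x _ hx => by rw [mul_smul_comm]; exact N.smul_mem a hx) hu
    rintro _ ⟨⟨r, c⟩, hq, rfl⟩
    have hrc : P.rowLen r ≤ c := (hnotmem r c).1 hq
    have hle : (rowPoly k n b r).natDegree ≤ r + c := by rw [hdeg]; omega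
    fin_cases i
    · change MvPolynomial.X 0 * (rowPoly k n b r).homogenize (r + c) ∈ N
      have hsucc : stringVec (rowPoly k n b) (r + 1, c) ∈ N :=
        hNmem _ _ ((P.rowLen_anti r (r + 1) (by omega)).trans hrc)
      rw [X_zero_mul_homogenize _ _ hle]
      rcases X_mul_rowPoly (k := k) h r with e | ⟨j, hj, hj1, hj2, e⟩
      · rw [e, add_right_comm]; exact hsucc
      · have l1 := h.lt_succ j (by omega)
        rw [e, homogenize_sub]
        refine sub_mem (by rw [add_right_comm]; exact hsucc) ?_
        -- The correction term lies in N: from r + 1 = b (j + 2) and c ≥ 2d - b (j + 1) - b (j + 2)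
        -- follows r + c + 1 - b j ≥ 2d - b j - b (j + 1), the length of row b j.
        have hr1 := hrow j (b j) le_rfl l1
        have hr2 := hrow (j + 1) r hj1 (by rw [show j + 1 + 1 = j + 2 from rfl]; omega)
        rw [show j + 1 + 1 = j + 2 from rfl] at hr2
        have l2 := h.le_top (j + 2)
        have := hNmem (b j) (r + c + 1 - b j) (by omega)
        rwa [stringVec, show b j + (r + c + 1 - b j) = r + c + 1 by omega] at this
    · change MvPolynomial.X 1 * (rowPoly k n b r).homogenize (r + c) ∈ N
      rw [X_one_mul_homogenize _ _ hle]
      exact hNmem r (c + 1) (by omega)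
  have hI : (blockIdeal k d n b).restrictScalars k = N := by
    apply le_antisymm
    · refine span_le_ideal_of_mul_X_mem hX ?_
      rintro _ (rfl | rfl)
      · have := hNmem d 0 (hrow0 d le_rfl).le
        have e := rowPoly_block (k := k) h (le_refl n)
        rw [h.eq_top n le_rfl] at e
        rwa [stringVec, e] at this
      · have e := rowPoly_block (k := k) h (show n - 1 ≤ n by omega)
        have l1 := h.lt_succ (n - 1) (by omega)
        have hr := hrow (n - 1) _ le_rfl l1
        rw [show n - 1 + 1 = n by omega, h.eq_top n le_rfl] at hr l1
        have := hNmem (b (n - 1)) (d - b (n - 1)) (by omega)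
        rwa [stringVec, e, show b (n - 1) + (d - b (n - 1)) = d by omega] at this
    · rw [Submodule.span_le]
      rintro _ ⟨⟨r, c⟩, hq, rfl⟩
      have hrc : P.rowLen r ≤ c := (hnotmem r c).1 hq
      have hr := hrowi r
      have hle := blockIndex_le h r
      have hn : blockIndex n b r ≤ n := Nat.findGreatest_le n
      have hQ := homogenize_blockPoly_mem (k := k) h (n - blockIndex n b r) (by omega)
      rw [show n - (n - blockIndex n b r) = blockIndex n b r by omega] at hQ
      have hdQ := (blockPoly_monic_natDegree (k := k) h _ hn).2
      have l1 := h.monotone (show blockIndex n b r ≤ blockIndex n b r + 1 by omega)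
      have l2 := h.le_top (blockIndex n b r + 1)
      have e1 := X_one_pow_mul_homogenize (blockPoly k b (blockIndex n b r))
        (2 * d - b (blockIndex n b r + 1)) (c - P.rowLen r) (by omega)
      have e0 := X_zero_pow_mul_homogenize (blockPoly k b (blockIndex n b r))
        (2 * d - b (blockIndex n b r + 1) + (c - P.rowLen r)) (r - b (blockIndex n b r)) (by omega)
      rw [← e1, show 2 * d - b (blockIndex n b r + 1) + (c - P.rowLen r)
        + (r - b (blockIndex n b r)) = r + c by omega] at e0
      change (rowPoly k n b r).homogenize (r + c) ∈ blockIdeal k d n b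
      rw [rowPoly, ← e0]
      exact Ideal.mul_mem_left _ _ (Ideal.mul_mem_left _ _ hQ)
  have hJ := isJordanType_of_eq_span hW hdeg _ P hI
  refine ⟨blockIdeal k d n b, ⟨?_, ?_, _, _, d, d, isHomogeneous_homogenize _,
    isHomogeneous_homogenize _, rfl⟩, MvPolynomial.X 1, MvPolynomial.isHomogeneous_X _ _, hJ⟩
  · obtain ⟨B, -⟩ := hJ
    intro htop
    have h00 : ((0, 0) : ℕ × ℕ) ∈ P.cells := by
      rw [YoungDiagram.mem_cells, YoungDiagram.mem_iff_lt_rowLen]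
      have l1 := h.lt_succ 0 (by omega)
      have hr := hrow 0 0 (by rw [h.zero]) (by rw [h.zero] at l1; exact l1)
      rw [h.zero] at hr
      have := h.le_top (0 + 1)
      omega
    have : Subsingleton (MvPolynomial (Fin 2) k ⧸ blockIdeal k d n b) :=
      Ideal.Quotient.subsingleton_iff.2 htop
    exact B.ne_zero ⟨_, h00⟩ (Subsingleton.elim _ _)
  · obtain ⟨B, -⟩ := hJ
    exact Module.Finite.of_basis B

end Construction

/-! ### Graded ideals, normalized generators and Macaulay duality -/

section Graded

variable {k : Type*} [Field k]

theorem homogeneousComponent_mul_right {f : MvPolynomial (Fin 2) k} {m : ℕ}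
    (hf : f.IsHomogeneous m) (a : MvPolynomial (Fin 2) k) (t : ℕ) :
    MvPolynomial.homogeneousComponent t (a * f)
      = if m ≤ t then MvPolynomial.homogeneousComponent (t - m) a * f else 0 := by
  let _ := MvPolynomial.gradedAlgebra (σ := Fin 2) (R := k)
  have key : ∀ (φ : MvPolynomial (Fin 2) k) (i : ℕ),
      (DirectSum.decompose (MvPolynomial.homogeneousSubmodule (Fin 2) k) φ i :
        MvPolynomial (Fin 2) k) = MvPolynomial.homogeneousComponent i φ :=
    MvPolynomial.decomposition.decompose'_apply
  have h := DirectSum.coe_decompose_mul_of_right_mem (MvPolynomial.homogeneousSubmodule (Fin 2) k)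
    (a := a) t hf
  rwa [key, key] at h

/-- An ideal stable under taking homogeneous components. -/
def IsGradedIdeal (I : Ideal (MvPolynomial (Fin 2) k)) : Prop :=
  ∀ u ∈ I, ∀ t, MvPolynomial.homogeneousComponent t u ∈ I

theorem isGradedIdeal_span_pair {f g : MvPolynomial (Fin 2) k} {m n : ℕ}
    (hf : f.IsHomogeneous m) (hg : g.IsHomogeneous n) :
    IsGradedIdeal (Ideal.span {f, g}) := by
  intro u hu t
  obtain ⟨a, b, rfl⟩ := Ideal.mem_span_pair.1 hu
  rw [map_add, homogeneousComponent_mul_right hf, homogeneousComponent_mul_right hg]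
  refine add_mem ?_ ?_
  · split_ifs
    · exact Ideal.mul_mem_left _ _ (Ideal.subset_span (by simp))
    · exact zero_mem _
  · split_ifs
    · exact Ideal.mul_mem_left _ _ (Ideal.subset_span (by simp))
    · exact zero_mem _

/-- The class of `X i` is integral over k; the top homogeneous component of its monic equation is a
pure power of `X i`. -/
theorem exists_X_pow_mem {I : Ideal (MvPolynomial (Fin 2) k)} (hI : IsGradedIdeal I)
    [Module.Finite k (MvPolynomial (Fin 2) k ⧸ I)] (i : Fin 2) :
    ∃ N, (MvPolynomial.X i : MvPolynomial (Fin 2) k) ^ N ∈ I := by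
  obtain ⟨q, hq, hq0⟩ := Algebra.IsIntegral.isIntegral (R := k)
    (Ideal.Quotient.mk I (MvPolynomial.X i))
  have hmem : aeval (MvPolynomial.X i : MvPolynomial (Fin 2) k) q ∈ I := by
    rw [← Ideal.Quotient.eq_zero_iff_mem]
    have := Polynomial.aeval_algHom_apply (Ideal.Quotient.mkₐ k I)
      (MvPolynomial.X i : MvPolynomial (Fin 2) k) q
    rw [Ideal.Quotient.mkₐ_eq_mk] at this
    rw [← this]
    exact hq0
  refine ⟨q.natDegree, ?_⟩
  have h := hI _ hmem q.natDegree
  rw [aeval_eq_sum_range, map_sum, Finset.sum_eq_single q.natDegree] at h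
  · rw [hq.coeff_natDegree, one_smul, MvPolynomial.homogeneousComponent_of_mem
      (MvPolynomial.isHomogeneous_X_pow i _), if_pos rfl] at h
    exact h
  · intro j _ hj
    rw [map_smul, MvPolynomial.homogeneousComponent_of_mem
      (MvPolynomial.isHomogeneous_X_pow i _), if_neg (Ne.symm hj), smul_zero]
  · intro h'; simp at h'

theorem eval_one_zero_homogenize (p : k[X]) (n : ℕ) :
    MvPolynomial.eval ![1, 0] (p.homogenize n) = p.coeff n := by
  rw [homogenize, map_sum, Finset.sum_eq_single (n, 0)]
  · simp [Finsupp.update_eq_add_single, MvPolynomial.eval_monomial, Finsupp.prod_fintype]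
  · rintro ⟨a, c⟩ h hne
    have hc : c ≠ 0 := by
      rintro rfl
      simp at h; exact hne (by rw [h])
    simp [MvPolynomial.eval_monomial, Finsupp.prod_fintype, hc]
  · intro h; simp at h

/-- A graded complete intersection has generators `f, g` such that `f(X, 1)` is monic of the degree
of `f` and coprime to `g(X, 1)`. -/
theorem IsGradedCI.exists_generators {I : Ideal (MvPolynomial (Fin 2) k)} (hI : IsGradedCI I) :
    IsGradedIdeal I ∧ ∃ (F G : k[X]) (n : ℕ), F.Monic ∧ G.natDegree ≤ n ∧ IsCoprime F G ∧
      I = Ideal.span {F.homogenize F.natDegree, G.homogenize n} := by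
  obtain ⟨-, hfin, f, g, m, n, hf, hg, hspan⟩ := hI
  have hgr : IsGradedIdeal I := hspan ▸ isGradedIdeal_span_pair hf hg
  refine ⟨hgr, ?_⟩
  obtain ⟨N, hN⟩ := exists_X_pow_mem hgr 0
  obtain ⟨M, hM⟩ := exists_X_pow_mem hgr 1
  obtain ⟨F, hF, rfl⟩ := homogeneous_eq_homogenize hf
  obtain ⟨G, hG, rfl⟩ := homogeneous_eq_homogenize hg
  have main : ∀ (F G : k[X]) (m n : ℕ), F.natDegree ≤ m → G.natDegree ≤ n →
      I = Ideal.span {F.homogenize m, G.homogenize n} → F.coeff m ≠ 0 →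
      ∃ (F G : k[X]) (n : ℕ), F.Monic ∧ G.natDegree ≤ n ∧ IsCoprime F G ∧
      I = Ideal.span {F.homogenize F.natDegree, G.homogenize n} := by
    intro F G m n hF hG hspan hm
    have hFm : F.natDegree = m := le_antisymm hF (le_natDegree_of_ne_zero hm)
    have hF0 : F ≠ 0 := by rintro rfl; simp at hm
    have hu : F.leadingCoeff⁻¹ ≠ 0 := inv_ne_zero (leadingCoeff_ne_zero.2 hF0)
    have hspan' : I = Ideal.span {(C F.leadingCoeff⁻¹ * F).homogenize m, G.homogenize n} := by
      rw [hspan, homogenize_C_mul, Ideal.span_insert, Ideal.span_insert _ {G.homogenize n},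
        Ideal.span_singleton_mul_left_unit ((isUnit_iff_ne_zero.2 hu).map MvPolynomial.C)]
    have hdeg : (C F.leadingCoeff⁻¹ * F).natDegree = m := by
      rw [natDegree_C_mul hu, hFm]
    refine ⟨C F.leadingCoeff⁻¹ * F, G, n, ?_, hG, ?_, by rw [hdeg]; exact hspan'⟩
    · rw [mul_comm]; exact monic_mul_leadingCoeff_inv hF0
    -- Setting `X 1 = 1` in an expression of `X 1 ^ M` by the generators gives a Bézout identity.
    · rw [hspan'] at hM
      obtain ⟨a, b, hab⟩ := Ideal.mem_span_pair.1 hM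
      refine ⟨MvPolynomial.aeval ![X, 1] a, MvPolynomial.aeval ![X, 1] b, ?_⟩
      have := congrArg (MvPolynomial.aeval ![(X : k[X]), 1]) hab
      rw [map_add, map_mul, map_mul, aeval_homogenize_X_one _ hdeg.le,
        aeval_homogenize_X_one _ hG] at this
      simpa using this
  by_cases hFm : F.coeff m = 0
  · by_cases hGn : G.coeff n = 0
    -- Both generators would vanish at the point (1, 0), where `X 0 ^ N` does not.
    · exfalso
      rw [hspan] at hN
      obtain ⟨a, b, hab⟩ := Ideal.mem_span_pair.1 hN
      have := congrArg (MvPolynomial.eval ![(1 : k), 0]) hab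
      rw [map_add, map_mul, map_mul, eval_one_zero_homogenize, eval_one_zero_homogenize, hFm,
        hGn] at this
      simp at this
    · exact main G F n m hG hF (by rw [hspan, Ideal.span_pair_comm]) hGn
  · exact main F G m n hF hG hspan hFm

theorem modByMonic_eq_of_eq_add_mul {F A B q : k[X]} (hF : F.Monic) (h : A = B + F * q)
    (hB : B.degree < F.degree) : A %ₘ F = B :=
  (div_modByMonic_unique q B hF ⟨h.symm, hB⟩).2

/-- Macaulay duality for complete intersections of height two, written in the affine chart
`X 1 = 1`. -/
theorem exists_dual_functional {F G : k[X]} {n : ℕ} (hF : F.Monic) (hG : G.natDegree ≤ n)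
    (hco : IsCoprime F G) :
    ∃ L : k[X] →ₗ[k] k, ∀ (U : k[X]) (t : ℕ), U.natDegree ≤ t →
      (U.homogenize t ∈ Ideal.span {F.homogenize F.natDegree, G.homogenize n} ↔
        ∀ V : k[X], V.natDegree + t + 1 ≤ F.natDegree + n - 1 → L (U * V) = 0) := by
  obtain ⟨Z, H, hZH⟩ := hco
  set m := F.natDegree with hm
  -- H is the inverse of G modulo F, so L is a residue functional: the X ^ (m - 1)-coefficient of U
  -- * G⁻¹ mod F. Membership of U in degree t amounts to the remainder of U * H being zero or of
  -- degree at most t - n.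
  let L : k[X] →ₗ[k] k :=
    lcoeff k (m - 1) ∘ₗ modByMonicHom F ∘ₗ LinearMap.mulRight k H
  have hL : ∀ U, L U = ((U * H) %ₘ F).coeff (m - 1) := fun U => rfl
  have hFdeg : F.degree = m := degree_eq_natDegree hF.ne_zero
  refine ⟨L, fun U t hU => ⟨fun hmem V hV => ?_, fun hL0 => ?_⟩⟩
  · obtain ⟨a, b, hab⟩ := Ideal.mem_span_pair.1 hmem
    obtain ⟨q, r, hr, hUqr⟩ : ∃ q r : k[X], (r = 0 ∨ r.natDegree + n ≤ t) ∧ U = q * F + r * G := by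
      have h := congrArg (MvPolynomial.homogeneousComponent t) hab
      rw [map_add, homogeneousComponent_mul_right (isHomogeneous_homogenize F),
        homogeneousComponent_mul_right (isHomogeneous_homogenize G),
        MvPolynomial.homogeneousComponent_of_mem (isHomogeneous_homogenize U), if_pos rfl] at h
      have h' := congrArg (MvPolynomial.aeval ![(X : k[X]), 1]) h
      rw [map_add, aeval_homogenize_X_one _ hU] at h'
      refine ⟨if m ≤ t then MvPolynomial.aeval ![X, 1]
          (MvPolynomial.homogeneousComponent (t - m) a) else 0,
        if n ≤ t then MvPolynomial.aeval ![X, 1]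
          (MvPolynomial.homogeneousComponent (t - n) b) else 0, ?_, ?_⟩
      · split_ifs with hnt
        · right
          obtain ⟨p, hp, hpe⟩ := homogeneous_eq_homogenize
            (MvPolynomial.homogeneousComponent_isHomogeneous (t - n) b)
          rw [hpe, aeval_homogenize_X_one _ hp]
          omega
        · left; rfl
      · rw [← h']
        congr 1
        · split_ifs
          · rw [map_mul, aeval_homogenize_X_one _ hm.ge]
          · simp
        · split_ifs
          · rw [map_mul, aeval_homogenize_X_one _ hG]
          · simp
    have hmod : (U * V * H) %ₘ F = r * V := by
      refine modByMonic_eq_of_eq_add_mul hF (q := q * V * H - r * V * Z) ?_ ?_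
      · rw [hUqr]; linear_combination (r * V) * hZH
      · rcases hr with rfl | hr
        · rw [zero_mul, degree_zero, hFdeg]; exact WithBot.bot_lt_coe _
        · refine lt_of_le_of_lt degree_le_natDegree ?_
          rw [hFdeg]
          have := natDegree_mul_le (p := r) (q := V)
          exact_mod_cast (by omega : (r * V).natDegree < m)
    rw [hL, hmod]
    rcases hr with rfl | hr
    · simp
    · apply coeff_eq_zero_of_natDegree_lt
      have := natDegree_mul_le (p := r) (q := V)
      omega
  · set r := (U * H) %ₘ F with hr
    have hrdeg : r.degree < F.degree := degree_modByMonic_lt _ hF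
    have hUH : U * H = r + F * ((U * H) /ₘ F) := (modByMonic_add_div _ F).symm
    have hrt : r = 0 ∨ r.natDegree + n ≤ t := by
      by_contra! hcon
      obtain ⟨hr0, hrn⟩ := hcon
      have hrm : r.natDegree < m := natDegree_lt_natDegree hr0 hrdeg
      have hXr : (r * X ^ (m - 1 - r.natDegree)).natDegree = m - 1 := by
        rw [natDegree_mul_X_pow _ hr0]
        omega
      have hmod : (U * X ^ (m - 1 - r.natDegree) * H) %ₘ F = r * X ^ (m - 1 - r.natDegree) := by
        refine modByMonic_eq_of_eq_add_mul hF
          (q := (U * H) /ₘ F * X ^ (m - 1 - r.natDegree)) ?_ ?_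
        · linear_combination (X ^ (m - 1 - r.natDegree)) * hUH
        · refine lt_of_le_of_lt degree_le_natDegree ?_
          rw [hFdeg, hXr]
          exact_mod_cast (by omega : m - 1 < m)
      -- This test monomial moves the leading coefficient of r to position m - 1, where L reads it;
      -- r.natDegree + n > t makes its degree admissible.
      have h0 := hL0 (X ^ (m - 1 - r.natDegree)) (by rw [natDegree_X_pow]; omega)
      have hc := coeff_natDegree (p := r * X ^ (m - 1 - r.natDegree))
      rw [hXr, leadingCoeff_mul_X_pow] at hc
      rw [hL, hmod, hc] at h0
      exact hr0 (leadingCoeff_eq_zero.1 h0)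
    obtain ⟨q, hq⟩ : ∃ q, U = r * G + F * q := by
      refine ⟨U * Z + ((U * H) /ₘ F) * G, ?_⟩
      linear_combination (-U) * hZH + G * hUH
    have hrG : (r * G).natDegree ≤ t := by
      rcases hrt with h0 | h0
      · rw [h0]; simp
      · exact natDegree_mul_le.trans (by omega)
    have hFq : (F * q).natDegree ≤ t := by
      rw [show F * q = U - r * G by rw [hq]; ring]
      exact (natDegree_sub_le _ _).trans (max_le hU hrG)
    rw [hq, homogenize_add]
    refine add_mem ?_ ?_
    · rcases hrt with h0 | h0
      · rw [h0]; simp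
      · have := homogenize_mul r G (m := t - n) (n := n) (by omega) hG
        rw [show t - n + n = t by omega] at this
        rw [this]
        exact Ideal.mul_mem_left _ _ (Ideal.subset_span (by simp))
    · by_cases hq0 : q = 0
      · rw [hq0]; simp
      · have hd := hF.natDegree_mul' hq0
        have := homogenize_mul F q (m := m) (n := t - m) hm.ge (by omega)
        rw [show m + (t - m) = t by omega] at this
        rw [this]
        exact Ideal.mul_mem_right _ _ (Ideal.subset_span (by simp))

end Graded

/-! ### Minimal string systems of a graded ideal -/

section NormalForm

variable {k : Type*} [Field k]

/-- `W i` is a monic polynomial of degree `i` whose homogenization is killed by `X 1 ^ p i` modulo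
`I`, and `p i` is the least exponent for which such a polynomial exists. -/
structure IsStringSystem (I : Ideal (MvPolynomial (Fin 2) k)) (p : ℕ → ℕ) (W : ℕ → k[X]) :
    Prop where
  monic : ∀ i, (W i).Monic
  natDegree_eq : ∀ i, (W i).natDegree = i
  mem : ∀ i, (W i).homogenize (i + p i) ∈ I
  le_of_mem : ∀ i q (V : k[X]), V.Monic → V.natDegree = i → V.homogenize (i + q) ∈ I → p i ≤ q

theorem exists_isStringSystem {I : Ideal (MvPolynomial (Fin 2) k)}
    (h1 : ∃ N, (MvPolynomial.X 1 : MvPolynomial (Fin 2) k) ^ N ∈ I) :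
    ∃ p W, IsStringSystem I p W := by
  classical
  obtain ⟨N, hN⟩ := h1
  have hex : ∀ i, ∃ q, ∃ V : k[X], V.Monic ∧ V.natDegree = i ∧ V.homogenize (i + q) ∈ I := by
    intro i
    refine ⟨N, X ^ i, monic_X_pow i, natDegree_X_pow i, ?_⟩
    rw [homogenize_X_pow (by omega), Nat.add_sub_cancel_left]
    exact Ideal.mul_mem_left _ _ hN
  choose W hWm hWd hWI using fun i => Nat.find_spec (hex i)
  exact ⟨fun i => Nat.find (hex i), W, hWm, hWd, hWI,
    fun i q V hV hd hI => Nat.find_min' (hex i) ⟨V, hV, hd, hI⟩⟩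

namespace IsStringSystem

variable {I : Ideal (MvPolynomial (Fin 2) k)} {p : ℕ → ℕ} {W : ℕ → k[X]}

theorem homogenize_mem (h : IsStringSystem I p W) {i t : ℕ} (ht : i + p i ≤ t) :
    (W i).homogenize t ∈ I := by
  have := X_one_pow_mul_homogenize (W i) (i + p i) (t - (i + p i))
    (by rw [h.natDegree_eq]; omega)
  rw [show i + p i + (t - (i + p i)) = t by omega] at this
  rw [← this]
  exact Ideal.mul_mem_left _ _ (h.mem i)

/-- X * W i competes in the minimum defining p (i + 1). -/
theorem antitone (h : IsStringSystem I p W) : Antitone p := by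
  refine antitone_nat_of_succ_le fun i => ?_
  refine h.le_of_mem (i + 1) (p i) (X * W i) (monic_X.mul (h.monic i)) ?_ ?_
  · rw [monic_X.natDegree_mul (h.monic i), natDegree_X, h.natDegree_eq, add_comm]
  · have := X_zero_mul_homogenize (W i) (i + p i) (by rw [h.natDegree_eq]; omega)
    rw [add_right_comm, ← this]
    exact Ideal.mul_mem_left _ _ (h.mem i)

theorem exists_eq_zero (h : IsStringSystem I p W)
    (h0 : ∃ N, (MvPolynomial.X 0 : MvPolynomial (Fin 2) k) ^ N ∈ I) : ∃ M, ∀ i, M ≤ i → p i = 0 := by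
  obtain ⟨N, hN⟩ := h0
  have : p N ≤ 0 := by
    refine h.le_of_mem N 0 (X ^ N) (monic_X_pow N) (natDegree_X_pow N) ?_
    rw [homogenize_X_pow (by omega)]
    simpa using hN
  exact ⟨N, fun i hi => by have := h.antitone hi; omega⟩

/-- Division by leading terms: if U has degree i, minimality gives p i ≤ t - i, so a multiple of the
degree-t homogenization of W i can be subtracted within I, lowering the degree. -/
theorem mem_span_of_homogenize_mem (h : IsStringSystem I p W) (i : ℕ) :
    ∀ (U : k[X]) (t : ℕ), U.degree < i → i ≤ t + 1 → U.homogenize t ∈ I →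
      U.homogenize t ∈ Submodule.span k (stringVec W '' {q | p q.1 ≤ q.2}) := by
  induction i with
  | zero => intro U t hU _ _; simp at hU; simp [hU]
  | succ i ih =>
    intro U t hU hit hUI
    by_cases ha : U.coeff i = 0
    · refine ih U t ?_ (by omega) hUI
      rw [degree_lt_iff_coeff_zero] at hU ⊢
      intro m hm
      rcases hm.lt_or_eq with hlt | rfl
      · exact hU m hlt
      · exact ha
    · have hdeg : U.natDegree = i := by
        refine le_antisymm ?_ (le_natDegree_of_ne_zero ha)
        have hU0 : U ≠ 0 := by rintro rfl; simp at ha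
        have := (natDegree_lt_iff_degree_lt hU0).2 hU
        omega
      have hlead : U.leadingCoeff = U.coeff i := by rw [leadingCoeff, hdeg]
      have hp : p i ≤ t - i := by
        refine h.le_of_mem i (t - i) (C (U.coeff i)⁻¹ * U) ?_ ?_ ?_
        · rw [← hlead, mul_comm]
          exact monic_mul_leadingCoeff_inv (by rintro rfl; simp at ha)
        · rw [natDegree_C_mul (inv_ne_zero ha), hdeg]
        · rw [homogenize_C_mul, show i + (t - i) = t by omega]
          exact Ideal.mul_mem_left _ _ hUI
      have hWi : (W i).homogenize t ∈ I := h.homogenize_mem (by omega)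
      have hsub : (U - U.coeff i • W i).degree < i :=
        degree_sub_coeff_smul_lt hdeg.le (h.monic i) (h.natDegree_eq i)
      have hmem : (U - U.coeff i • W i).homogenize t ∈ I := by
        rw [homogenize_sub, homogenize_smul, ← MvPolynomial.C_mul']
        exact sub_mem hUI (Ideal.mul_mem_left _ _ hWi)
      have h2 := ih _ t hsub (by omega) hmem
      have h3 : (W i).homogenize t ∈ Submodule.span k (stringVec W '' {q | p q.1 ≤ q.2}) :=
        Submodule.subset_span ⟨(i, t - i), hp, by
          rw [stringVec, show i + (t - i) = t by omega]⟩
      have h4 : U.homogenize t = (U - U.coeff i • W i).homogenize t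
          + U.coeff i • (W i).homogenize t := by
        rw [homogenize_sub, homogenize_smul, sub_add_cancel]
      rw [h4]
      exact add_mem h2 (Submodule.smul_mem _ _ h3)

theorem restrictScalars_eq_span (h : IsStringSystem I p W) (hI : IsGradedIdeal I) :
    I.restrictScalars k = Submodule.span k (stringVec W '' {q | p q.1 ≤ q.2}) := by
  apply le_antisymm
  · intro u hu
    rw [← u.sum_homogeneousComponent]
    refine Submodule.sum_mem _ fun t _ => ?_
    have ht := hI u hu t
    obtain ⟨U, hU, hUe⟩ := homogeneous_eq_homogenize
      (MvPolynomial.homogeneousComponent_isHomogeneous t u)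
    rw [hUe] at ht ⊢
    exact h.mem_span_of_homogenize_mem (t + 1) U t
      (lt_of_le_of_lt degree_le_natDegree (by exact_mod_cast Nat.lt_succ_of_le hU)) le_rfl ht
  · rw [Submodule.span_le]
    rintro _ ⟨q, hq, rfl⟩
    exact h.homogenize_mem (Nat.add_le_add_left hq _)

/-- The row lengths of the Jordan type of multiplication by `X 1` are the string lengths. -/
theorem rowLen_eq (h : IsStringSystem I p W) (hI : IsGradedIdeal I)
    (h0 : ∃ N, (MvPolynomial.X 0 : MvPolynomial (Fin 2) k) ^ N ∈ I) {P : YoungDiagram}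
    (hP : IsJordanType (LinearMap.mulLeft k (Ideal.Quotient.mk I (MvPolynomial.X 1))) P) (i : ℕ) :
    P.rowLen i = p i := by
  obtain ⟨M, hM⟩ := h.exists_eq_zero h0
  let Q : YoungDiagram :=
    { cells := (Finset.range M ×ˢ Finset.range (p 0)).filter fun c => c.2 < p c.1
      isLowerSet := by
        rintro ⟨a, b⟩ ⟨a', b'⟩ hle hab
        obtain ⟨h1, h2⟩ : a' ≤ a ∧ b' ≤ b := hle
        simp only [Finset.coe_filter, Finset.mem_product, Finset.mem_range,
          Set.mem_ofPred_eq] at hab ⊢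
        have := h.antitone h1
        omega }
  have hQ : ∀ q, q ∈ Q ↔ q.2 < p q.1 := by
    intro q
    rw [← YoungDiagram.mem_cells]
    simp only [Q, Finset.mem_filter, Finset.mem_product, Finset.mem_range]
    refine ⟨fun hq => hq.2, fun hq => ⟨⟨?_, ?_⟩, hq⟩⟩
    · by_contra hc
      have := hM q.1 (not_lt.1 hc)
      omega
    · have := h.antitone (Nat.zero_le q.1)
      omega
  have hset : {q | q ∉ Q} = {q : ℕ × ℕ | p q.1 ≤ q.2} := by
    ext q
    rw [Set.mem_ofPred_eq, hQ, not_lt, Set.mem_ofPred_eq]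
  have hJ := isJordanType_of_eq_span h.monic h.natDegree_eq I Q
    (by rw [hset]; exact h.restrictScalars_eq_span hI)
  rw [hP.unique hJ]
  have key : ∀ j, j < Q.rowLen i ↔ j < p i := fun j => by
    rw [← YoungDiagram.mem_iff_lt_rowLen, hQ]
  exact le_antisymm (le_of_not_gt fun hc => lt_irrefl _ ((key _).1 hc))
    (le_of_not_gt fun hc => lt_irrefl _ ((key _).2 hc))

end IsStringSystem

end NormalForm

theorem eq_self_of_injOn_of_le {S : Set ℕ} {τ : ℕ → ℕ} (hmaps : Set.MapsTo τ S S)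
    (hinj : Set.InjOn τ S) (hle : ∀ i ∈ S, τ i ≤ i) : ∀ i ∈ S, τ i = i := by
  intro i
  induction i using Nat.strong_induction_on with
  | _ i ih =>
  intro hi
  rcases (hle i hi).lt_or_eq with hlt | heq
  · exact hinj (hmaps hi) hi (ih _ hlt (hmaps hi))
  · exact heq

/-! ### Symmetry of the string lengths from duality -/

section Symmetry

variable {k : Type*} [Field k] {I : Ideal (MvPolynomial (Fin 2) k)} {p : ℕ → ℕ} {W : ℕ → k[X]}
  {L : k[X] →ₗ[k] k} {D : ℕ}

/-- Put s = D - i - p i. By minimality of p i, U pairs nontrivially with some V of degree at most s;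
by `hUI` it is orthogonal to everything of degree below s. Hence V may be replaced by W s. -/
theorem IsStringSystem.dual_row_ne_zero (h : IsStringSystem I p W)
    (hL : ∀ (U : k[X]) (t : ℕ), U.natDegree ≤ t →
      (U.homogenize t ∈ I ↔ ∀ V : k[X], V.natDegree + t + 1 ≤ D → L (U * V) = 0))
    {i : ℕ} (hi : 0 < p i) {U : k[X]} (hU : U.Monic) (hUd : U.natDegree = i)
    (hUI : U.homogenize (i + p i) ∈ I) :
    i + p i ≤ D ∧ L (U * W (D - i - p i)) ≠ 0 := by
  have hnot : U.homogenize (i + (p i - 1)) ∉ I := fun hmem => by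
    have := h.le_of_mem i _ U hU hUd hmem
    omega
  rw [hL U _ (by omega)] at hnot hUI
  push Not at hnot
  obtain ⟨V, hV, hLV⟩ := hnot
  refine ⟨by omega, fun hzero => hLV ?_⟩
  set s := D - i - p i with hs
  have hlow : L (U * (V - V.coeff s • W s)) = 0 := by
    by_cases h0 : V - V.coeff s • W s = 0
    · rw [h0]; simp
    · refine hUI _ ?_
      have : (V - V.coeff s • W s).natDegree < s := by
        rw [natDegree_lt_iff_degree_lt h0]
        exact degree_sub_coeff_smul_lt (by omega) (h.monic s) (h.natDegree_eq s)
      omega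
  rw [mul_sub, map_sub, mul_smul_comm, map_smul, hzero, smul_zero, sub_zero] at hlow
  exact hlow

theorem IsStringSystem.symmetric (h : IsStringSystem I p W)
    (hL : ∀ (U : k[X]) (t : ℕ), U.natDegree ≤ t →
      (U.homogenize t ∈ I ↔ ∀ V : k[X], V.natDegree + t + 1 ≤ D → L (U * V) = 0))
    (i : ℕ) (hi : 0 < p i) : i + p i ≤ D ∧ p (D - i - p i) = p i := by
  let σ : ℕ → ℕ := fun i => D - i - p i
  have hne : ∀ i, 0 < p i → i + p i ≤ D ∧ L (W i * W (σ i)) ≠ 0 := fun i hi =>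
    h.dual_row_ne_zero hL hi (h.monic i) (h.natDegree_eq i) (h.mem i)
  have hge : ∀ i, 0 < p i → p i ≤ p (σ i) := by
    intro i hi
    obtain ⟨hD, hLi⟩ := hne i hi
    -- If p (σ i) < p i, the membership of W (σ i) in I in degree σ i + p (σ i) already forces its
    -- pairing with W i to vanish.
    by_contra! hlt
    refine hLi ?_
    rw [mul_comm]
    refine (hL (W (σ i)) (σ i + p (σ i)) (by rw [h.natDegree_eq]; omega)).1 (h.mem _) (W i) ?_
    rw [h.natDegree_eq]
    simp only [σ] at hlt ⊢
    omega
  have hmaps : Set.MapsTo σ {i | 0 < p i} {i | 0 < p i} := fun i hi =>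
    lt_of_lt_of_le hi (hge i hi)
  have hlt : ∀ i₁ i₂, 0 < p i₁ → 0 < p i₂ → σ i₁ = σ i₂ → ¬ i₁ < i₂ := by
    intro i₁ i₂ h1 h2 he hlt
    obtain ⟨hD1, hL1⟩ := hne i₁ h1
    obtain ⟨hD2, hL2⟩ := hne i₂ h2
    have hsum : i₁ + p i₁ = i₂ + p i₂ := by simp only [σ] at he; omega
    -- The scalar is chosen so that W i₂ - c • W i₁, another minimal generator of string i₂, pairs
    -- to zero with W (σ i₂), against `dual_row_ne_zero`.
    set c := L (W i₂ * W (σ i₂)) / L (W i₁ * W (σ i₁)) with hc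
    have hdlt : (c • W i₁).degree < (W i₂).degree := by
      refine lt_of_le_of_lt (degree_smul_le _ _) (degree_lt_degree ?_)
      rw [h.natDegree_eq, h.natDegree_eq]; exact hlt
    have hmon : (W i₂ - c • W i₁).Monic := (h.monic i₂).sub_of_left hdlt
    have hdeg : (W i₂ - c • W i₁).natDegree = i₂ := by
      rw [natDegree_eq_of_degree_eq (degree_sub_eq_left_of_degree_lt hdlt), h.natDegree_eq]
    have hmem : (W i₂ - c • W i₁).homogenize (i₂ + p i₂) ∈ I := by
      rw [homogenize_sub, homogenize_smul, ← MvPolynomial.C_mul']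
      exact sub_mem (h.mem i₂) (Ideal.mul_mem_left _ _ (hsum ▸ h.mem i₁))
    refine (h.dual_row_ne_zero hL h2 hmon hdeg hmem).2 ?_
    change L (_ * W (σ i₂)) = 0
    rw [sub_mul, map_sub, smul_mul_assoc, map_smul, ← he, hc, he, smul_eq_mul, ← he,
      div_mul_cancel₀ _ hL1, sub_self]
  have hinj : Set.InjOn σ {i | 0 < p i} := by
    intro i₁ h1 i₂ h2 he
    have := hlt i₁ i₂ h1 h2 he
    have := hlt i₂ i₁ h2 h1 he.symm
    omega
  -- σ (σ i) = i + p i - p (σ i) ≤ i, so the injective map σ ∘ σ is the identity and the two lengths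
  -- agree.
  have hinv := eq_self_of_injOn_of_le (hmaps.comp hmaps) (hinj.comp hinj hmaps) (fun i hi => by
    have h1 := hge i hi
    have h2 := (hne i hi).1
    simp only [Function.comp, σ] at h1 ⊢
    omega) i hi
  have h1 := (hne i hi).1
  have h2 := (hne (σ i) (hmaps hi)).1
  refine ⟨h1, ?_⟩
  simp only [Function.comp, σ] at hinv h2 ⊢
  omega

end Symmetry

/-- The rows of the Jordan type of a complete intersection are symmetric: the row `i` is matched
with the row `D - i - P.rowLen i` of the same length. -/
theorem exists_symmetric_rows {k : Type*} [Field k] {I : Ideal (MvPolynomial (Fin 2) k)}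
    (hI : IsGradedCI I) {P : YoungDiagram}
    (hP : IsJordanType (LinearMap.mulLeft k (Ideal.Quotient.mk I (MvPolynomial.X 1))) P) :
    ∃ D, ∀ i, 0 < P.rowLen i → i + P.rowLen i ≤ D ∧
      P.rowLen (D - i - P.rowLen i) = P.rowLen i := by
  obtain ⟨hgr, F, G, n, hF, hG, hco, hspan⟩ := hI.exists_generators
  have hfin := hI.2.1
  obtain ⟨p, W, h⟩ := exists_isStringSystem (exists_X_pow_mem hgr 1)
  have hrow := h.rowLen_eq hgr (exists_X_pow_mem hgr 0) hP
  obtain ⟨L, hL⟩ := exists_dual_functional hF hG hco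
  rw [← hspan] at hL
  refine ⟨F.natDegree + n - 1, fun i hi => ?_⟩
  rw [hrow] at hi ⊢
  rw [hrow]
  exact h.symmetric hL i hi

/-! ### Reduction to the linear form `X 1` -/

section CoordinateChange

variable {k : Type*} [Field k]

theorem exists_algEquiv_of_linear {a b : Fin 2 → MvPolynomial (Fin 2) k}
    (ha : ∀ i, (a i).IsHomogeneous 1) (hb : ∀ i, MvPolynomial.aeval b (a i) = MvPolynomial.X i)
    (hab : ∀ i, MvPolynomial.aeval a (b i) = MvPolynomial.X i) :
    ∃ ψ : MvPolynomial (Fin 2) k ≃ₐ[k] MvPolynomial (Fin 2) k, ψ (MvPolynomial.X 1) = b 1 ∧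
      ∀ f m, f.IsHomogeneous m → (ψ.symm f).IsHomogeneous m := by
  refine ⟨AlgEquiv.ofAlgHom (MvPolynomial.aeval b) (MvPolynomial.aeval a)
    (MvPolynomial.algHom_ext fun i => by
      rw [AlgHom.comp_apply, MvPolynomial.aeval_X, hb, AlgHom.id_apply])
    (MvPolynomial.algHom_ext fun i => by
      rw [AlgHom.comp_apply, MvPolynomial.aeval_X, hab, AlgHom.id_apply]),
    by simp, fun f m hf => ?_⟩
  have := hf.aeval a ha
  rw [one_mul] at this
  exact this

theorem exists_algEquiv_X_one {l : MvPolynomial (Fin 2) k} (hl : l.IsHomogeneous 1) (h0 : l ≠ 0) :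
    ∃ ψ : MvPolynomial (Fin 2) k ≃ₐ[k] MvPolynomial (Fin 2) k, ψ (MvPolynomial.X 1) = l ∧
      ∀ f m, f.IsHomogeneous m → (ψ.symm f).IsHomogeneous m := by
  obtain ⟨a, b, rfl⟩ : ∃ a b : k, l = MvPolynomial.C a * MvPolynomial.X 0
      + MvPolynomial.C b * MvPolynomial.X 1 := by
    obtain ⟨p, hp, rfl⟩ := homogeneous_eq_homogenize hl
    obtain ⟨a, b, rfl⟩ := exists_eq_X_add_C_of_natDegree_le_one hp
    exact ⟨a, b, by simp⟩
  have hX := MvPolynomial.isHomogeneous_C_mul_X (R := k) (σ := Fin 2)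
  by_cases hb : b = 0
  · have ha : a ≠ 0 := by rintro rfl; simp [hb] at h0
    have hinv : (MvPolynomial.C a⁻¹ * MvPolynomial.C a : MvPolynomial (Fin 2) k) = 1 := by
      rw [← map_mul, inv_mul_cancel₀ ha, map_one]
    obtain ⟨ψ, h1, h2⟩ := exists_algEquiv_of_linear
      (a := ![MvPolynomial.C a⁻¹ * MvPolynomial.X 1, MvPolynomial.X 0])
      (b := ![MvPolynomial.X 1, MvPolynomial.C a * MvPolynomial.X 0])
      (fun i => by
        fin_cases i
        · exact hX _ _
        · exact MvPolynomial.isHomogeneous_X k 0)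
      (fun i => by
        fin_cases i
        · simp only [Fin.zero_eta, Matrix.cons_val_one, map_mul, MvPolynomial.aeval_X,
            MvPolynomial.aeval_C, MvPolynomial.algebraMap_eq, Matrix.cons_val_zero]
          linear_combination (MvPolynomial.X 0) * hinv
        · simp)
      (fun i => by
        fin_cases i
        · simp
        · simp only [Fin.mk_one, Matrix.cons_val_one, map_mul, MvPolynomial.aeval_X,
            MvPolynomial.aeval_C, MvPolynomial.algebraMap_eq, Matrix.cons_val_zero]
          linear_combination (MvPolynomial.X 1) * hinv)
    exact ⟨ψ, by rw [h1, hb]; simp, h2⟩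
  · have hinv : (MvPolynomial.C b⁻¹ * MvPolynomial.C b : MvPolynomial (Fin 2) k) = 1 := by
      rw [← map_mul, inv_mul_cancel₀ hb, map_one]
    obtain ⟨ψ, h1, h2⟩ := exists_algEquiv_of_linear
      (a := ![MvPolynomial.X 0,
        MvPolynomial.C b⁻¹ * (MvPolynomial.X 1 - MvPolynomial.C a * MvPolynomial.X 0)])
      (b := ![MvPolynomial.X 0,
        MvPolynomial.C a * MvPolynomial.X 0 + MvPolynomial.C b * MvPolynomial.X 1])
      (fun i => by
        fin_cases i
        · exact MvPolynomial.isHomogeneous_X k 0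
        · exact ((MvPolynomial.isHomogeneous_X k 1).sub (hX _ _)).C_mul _)
      (fun i => by
        fin_cases i
        · simp
        · simp only [Fin.mk_one, Matrix.cons_val_one, map_mul, map_sub, MvPolynomial.aeval_X,
            MvPolynomial.aeval_C, MvPolynomial.algebraMap_eq, Matrix.cons_val_zero]
          linear_combination (MvPolynomial.X 1) * hinv)
      (fun i => by
        fin_cases i
        · simp
        · simp only [Fin.mk_one, Matrix.cons_val_one, map_mul, map_add, MvPolynomial.aeval_X,
            MvPolynomial.aeval_C, MvPolynomial.algebraMap_eq, Matrix.cons_val_zero]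
          linear_combination (MvPolynomial.X 1 - MvPolynomial.C a * MvPolynomial.X 0) * hinv)
    exact ⟨ψ, h1, h2⟩

theorem IsJordanType.congr {V V' : Type*} [AddCommGroup V] [Module k V] [AddCommGroup V']
    [Module k V'] {φ : Module.End k V} {φ' : Module.End k V'} {P : YoungDiagram}
    (h : IsJordanType φ P) (e : V ≃ₗ[k] V') (he : ∀ v, e (φ v) = φ' (e v)) :
    IsJordanType φ' P := by
  obtain ⟨b, hb⟩ := h
  refine ⟨b.map e, fun c => ?_⟩
  rw [Module.Basis.map_apply, ← he, hb]
  split_ifs with h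
  · rw [Module.Basis.map_apply]
  · exact map_zero e

/-- A row with two boxes excludes ℓ = 0, so ℓ can be completed to a linear coordinate system. -/
theorem IsCIJT.exists_isGradedCI {P : YoungDiagram} (h : IsCIJT k P) (h01 : (0, 1) ∈ P) :
    ∃ I : Ideal (MvPolynomial (Fin 2) k), IsGradedCI I ∧
      IsJordanType (LinearMap.mulLeft k (Ideal.Quotient.mk I (MvPolynomial.X 1))) P := by
  obtain ⟨I, ⟨hne, hfin, f, g, m, n, hf, hg, hspan⟩, l, hl, hJ⟩ := h
  have hl0 : l ≠ 0 := by
    rintro rfl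
    obtain ⟨b, hb⟩ := hJ
    have h00 : ((0, 0) : ℕ × ℕ) ∈ P.cells := P.up_left_mem le_rfl zero_le_one h01
    have := hb ⟨(0, 0), h00⟩
    rw [dif_pos (show ((0, 0 + 1) : ℕ × ℕ) ∈ P.cells from h01)] at this
    simp at this
    exact b.ne_zero _ this.symm
  obtain ⟨ψ, hψ, hhom⟩ := exists_algEquiv_X_one hl hl0
  let J : Ideal (MvPolynomial (Fin 2) k) := I.map (ψ.symm : _ →+* MvPolynomial (Fin 2) k)
  let e := Ideal.quotientEquivAlg I J ψ.symm rfl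
  have he : ∀ u, e (Ideal.Quotient.mk I u) = Ideal.Quotient.mk J (ψ.symm u) := fun u => rfl
  refine ⟨J, ⟨?_, ?_, ψ.symm f, ψ.symm g, m, n, hhom f m hf, hhom g n hg, ?_⟩, ?_⟩
  · intro htop
    have h1 : Subsingleton (MvPolynomial (Fin 2) k ⧸ J) := Ideal.Quotient.subsingleton_iff.2 htop
    exact hne (Ideal.Quotient.subsingleton_iff.1 e.toEquiv.subsingleton)
  · exact Module.Finite.equiv e.toLinearEquiv
  · simp only [J]
    rw [hspan, Ideal.map_span, Set.image_pair]
    rfl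
  · refine hJ.congr e.toLinearEquiv fun v => ?_
    change e (Ideal.Quotient.mk I l * v) = Ideal.Quotient.mk J (MvPolynomial.X 1) * e v
    rw [map_mul, he, ← hψ, AlgEquiv.symm_apply_apply]

end CoordinateChange

/-! ### Consequences of the diagonal lengths -/

section DiagonalLengths

variable {d : ℕ} {P : YoungDiagram}

theorem mem_of_card_diagonal {m : ℕ} (h : (P.cells.filter fun c => c.1 + c.2 = m).card = m + 1)
    {i j : ℕ} (hij : i + j = m) : (i, j) ∈ P := by
  have hsub : (P.cells.filter fun c => c.1 + c.2 = m) ⊆ Finset.HasAntidiagonal.antidiagonal m := fun c hc =>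
    Finset.HasAntidiagonal.mem_antidiagonal.2 (Finset.mem_filter.1 hc).2
  have heq := Finset.eq_of_subset_of_card_le hsub (by rw [h, Finset.Nat.card_antidiagonal])
  have hmem : (i, j) ∈ Finset.HasAntidiagonal.antidiagonal m := Finset.HasAntidiagonal.mem_antidiagonal.2 hij
  rw [← heq] at hmem
  exact (Finset.mem_filter.1 hmem).1

variable (hd : 2 ≤ d) (hP : HasDiagonalLengths P (peak d))
include hd hP

theorem mem_of_add_lt {i j : ℕ} (hij : i + j < d) : (i, j) ∈ P := by
  have h := hP (d - 1)
  rw [show peak d (d - 1) = d - 1 + 1 by unfold peak; omega] at h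
  exact P.up_left_mem (show i ≤ i by omega) (show j ≤ d - 1 - i by omega)
    (mem_of_card_diagonal h (by omega))

theorem add_lt_of_mem {i j : ℕ} (hij : (i, j) ∈ P) : i + j < 2 * d - 1 := by
  by_contra! hc
  have h := hP (i + j)
  rw [show peak d (i + j) = 0 by unfold peak; omega, Finset.card_eq_zero] at h
  have : (i, j) ∈ P.cells.filter fun c => c.1 + c.2 = i + j := Finset.mem_filter.2 ⟨hij, rfl⟩
  rw [h] at this
  simp at this

theorem exists_mem_top_degree : ∃ i j, (i, j) ∈ P ∧ i + j = 2 * d - 2 := by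
  have h := hP (2 * d - 2)
  rw [show peak d (2 * d - 2) = 1 by unfold peak; omega] at h
  obtain ⟨⟨i, j⟩, hij⟩ := Finset.card_pos.1 (by omega :
    0 < (P.cells.filter fun c => c.1 + c.2 = 2 * d - 2).card)
  exact ⟨i, j, Finset.mem_filter.1 hij⟩

/-- Diagonal d has d + 1 positions and d - 1 boxes, so one of its gaps avoids column 0. Thus
`lastGap` is a genuine positive gap and not the default 0 of `Nat.findGreatest`. -/
theorem exists_gap : ∃ i, 1 ≤ i ∧ i ≤ d ∧ (d - i, i) ∉ P := by
  by_contra! hc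
  have h := hP d
  rw [show peak d d = d - 1 by unfold peak; omega] at h
  have hsub : (Finset.HasAntidiagonal.antidiagonal d).erase (d, 0) ⊆ P.cells.filter fun c => c.1 + c.2 = d := by
    rintro ⟨a, b⟩ hab
    rw [Finset.mem_erase, Finset.HasAntidiagonal.mem_antidiagonal] at hab
    obtain ⟨hne, hsum⟩ := hab
    simp only at hsum
    have hb : b ≠ 0 := by rintro rfl; exact hne (by rw [← hsum]; rfl)
    have := hc b (by omega) (by omega)
    rw [show d - b = a by omega] at this
    exact Finset.mem_filter.2 ⟨this, hsum⟩
  have hcard := Finset.card_le_card hsub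
  rw [Finset.card_erase_of_mem (by simp), Finset.Nat.card_antidiagonal, h] at hcard
  omega

/-- A diagram of diagonal lengths `peak d` with symmetric rows has exactly `d` rows, and its
symmetry is `r ↦ 2 * d - 1 - r - P.rowLen r`. -/
theorem rows_of_symmetric {D : ℕ} (hD : ∀ i, 0 < P.rowLen i → i + P.rowLen i ≤ D ∧
      P.rowLen (D - i - P.rowLen i) = P.rowLen i) :
    D = 2 * d - 1 ∧ ∀ r, 0 < P.rowLen r ↔ r < d := by
  have hlow : ∀ r, r < d → d - r ≤ P.rowLen r := by
    intro r hr
    have := YoungDiagram.mem_iff_lt_rowLen.1 (mem_of_add_lt hd hP (i := r) (j := d - 1 - r)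
      (by omega))
    omega
  have h0 := hlow 0 (by omega)
  have hDeq : D = 2 * d - 1 := by
    apply le_antisymm
    -- The last box of the row matched with row 0 has degree D - 1, which is at most 2d - 2.
    · obtain ⟨h1, h2⟩ := hD 0 (by omega)
      have h3 := YoungDiagram.mem_iff_lt_rowLen.2 (show P.rowLen 0 - 1
        < P.rowLen (D - 0 - P.rowLen 0) by omega)
      have := add_lt_of_mem hd hP h3
      omega
    · obtain ⟨i, j, hij, hsum⟩ := exists_mem_top_degree hd hP
      have hj := YoungDiagram.mem_iff_lt_rowLen.1 hij
      have := (hD i (by omega)).1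
      omega
  refine ⟨hDeq, fun r => ⟨fun hr => ?_, fun hr => by have := hlow r hr; omega⟩⟩
  by_contra! hc
  -- A nonempty row d would be matched with row d - 1 - P.rowLen d, which is longer because it
  -- contains its row of the basic triangle.
  have hpd : 0 < P.rowLen d := hr.trans_le (P.rowLen_anti d r hc)
  obtain ⟨h1, h2⟩ := hD d hpd
  rcases lt_or_ge (D - d - P.rowLen d) d with hlt | hge
  · have := hlow _ hlt
    omega
  · omega

end DiagonalLengths

/-! ### Symmetric diagrams are block diagrams -/

/-- The first rows of the blocks of a symmetric diagram. -/
def blockStart (d : ℕ) (P : YoungDiagram) : ℕ → ℕ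
  | 0 => 0
  | k + 1 => 2 * d - blockStart d P k - P.rowLen (blockStart d P k)

theorem isBlockDiagram_of_symmetric {d : ℕ} {P : YoungDiagram} (hd : 1 ≤ d)
    (hpos : ∀ r, 0 < P.rowLen r ↔ r < d)
    (hsymm : ∀ r, r < d → r + P.rowLen r ≤ 2 * d - 1 ∧
      P.rowLen (2 * d - 1 - r - P.rowLen r) = P.rowLen r) : IsBlockDiagram d P := by
  have hzero : ∀ r, d ≤ r → P.rowLen r = 0 := fun r hr => by
    have := (hpos r).not.2 (by omega)
    omega
  -- Assume the rows from b on are stable under the involution. Row b and its partner 2d - 1 - b -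
  -- P.rowLen b have equal length, hence so do all rows between; they form a block, and the rows
  -- after it are again stable.
  have step : ∀ b, b < d → (∀ r, b ≤ r → r < d → b ≤ 2 * d - 1 - r - P.rowLen r) →
      b < 2 * d - b - P.rowLen b ∧ 2 * d - b - P.rowLen b ≤ d ∧
      (∀ r, 2 * d - b - P.rowLen b ≤ r → r < d →
        2 * d - b - P.rowLen b ≤ 2 * d - 1 - r - P.rowLen r) ∧
      ∀ r, b ≤ r → r < 2 * d - b - P.rowLen b → P.rowLen r = P.rowLen b := by
    intro b hb hinv
    obtain ⟨h1, h2⟩ := hsymm b hb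
    have h3 := hinv b le_rfl hb
    have h4 := (hpos (2 * d - 1 - b - P.rowLen b)).1 (by rw [h2]; exact (hpos b).2 hb)
    have hconst : ∀ r, b ≤ r → r < 2 * d - b - P.rowLen b → P.rowLen r = P.rowLen b := by
      intro r hbr hr
      apply le_antisymm (P.rowLen_anti b r hbr)
      rw [← h2]
      exact P.rowLen_anti _ _ (by omega)
    refine ⟨by omega, by omega, fun r hr hrd => ?_, hconst⟩
    by_contra! hc
    have h5 := hinv r (by omega) hrd
    have h6 := hconst _ h5 hc
    obtain ⟨h7, h8⟩ := hsymm r hrd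
    omega
  have hinv : ∀ k, blockStart d P k ≤ d ∧ ∀ r, blockStart d P k ≤ r → r < d →
      blockStart d P k ≤ 2 * d - 1 - r - P.rowLen r := by
    intro k
    induction k with
    | zero => exact ⟨by simp [blockStart], fun r _ _ => by simp [blockStart]⟩
    | succ k ih =>
      rcases ih.1.lt_or_eq with hlt | heq
      · have := step _ hlt ih.2
        exact ⟨this.2.1, this.2.2.1⟩
      · rw [blockStart, heq, hzero d le_rfl]
        exact ⟨by omega, fun r _ _ => by omega⟩
  have hfix : ∀ k, blockStart d P k = d → blockStart d P (k + 1) = d := fun k hk => by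
    rw [blockStart, hk, hzero d le_rfl]; omega
  -- The starts increase strictly until they reach d, so d is reached after at most d blocks.
  have hge : ∀ k, min k d ≤ blockStart d P k := by
    intro k
    induction k with
    | zero => simp
    | succ k ih =>
      rcases (hinv k).1.lt_or_eq with hlt | heq
      · have h1 := (step _ hlt (hinv k).2).1
        rw [blockStart]
        omega
      · rw [hfix k heq]; exact min_le_right _ _
  have hex : ∃ k, blockStart d P k = d :=
    ⟨d, le_antisymm (hinv d).1 (by simpa using hge d)⟩
  refine ⟨Nat.find hex, blockStart d P, ⟨?_, rfl, fun k hk => ?_, fun k hk => ?_⟩, ?_, hzero⟩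
  · rw [Nat.one_le_iff_ne_zero, Ne, Nat.find_eq_zero]
    simp only [blockStart]
    omega
  · have := Nat.find_min hex hk
    exact (step _ (lt_of_le_of_ne (hinv k).1 this) (hinv k).2).1
  · induction k, hk using Nat.le_induction with
    | base => exact Nat.find_spec hex
    | succ k _ ih => exact hfix k ih
  · intro k r h1 h2
    rcases (hinv k).1.lt_or_eq with hlt | heq
    · obtain ⟨s1, s2, s3, s4⟩ := step _ hlt (hinv k).2
      rw [blockStart] at h2 ⊢
      have := s4 r h1 h2
      have := (hsymm _ hlt).1
      omega
    · rw [hfix k heq] at h2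
      omega

theorem isBlockDiagram_of_isCIJT {k : Type*} [Field k] {d : ℕ} {P : YoungDiagram}
    (hd : 2 ≤ d) (hP : HasDiagonalLengths P (peak d)) (h : IsCIJT k P) : IsBlockDiagram d P := by
  obtain ⟨I, hI, hJ⟩ := h.exists_isGradedCI (mem_of_add_lt hd hP (by omega))
  obtain ⟨D, hD⟩ := exists_symmetric_rows hI hJ
  obtain ⟨rfl, hpos⟩ := rows_of_symmetric hd hP hD
  exact isBlockDiagram_of_symmetric (by omega) hpos fun r hr => hD r ((hpos r).2 hr)

/-! ### Block diagrams and branch labels -/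

section Label

theorem flatten_map_Ico (F : ℕ → ℕ) (b : ℕ → ℕ) (hb : Monotone b) (c : ℕ) :
    (List.ofFn fun i : Fin c => (List.Ico (b i) (b (i + 1))).map F).flatten
      = (List.Ico (b 0) (b c)).map F := by
  induction c with
  | zero => simp
  | succ c ih =>
    rw [List.ofFn_succ', List.concat_eq_append, List.flatten_append]
    simp only [Fin.val_castSucc, Fin.val_last]
    rw [ih]
    simp only [List.flatten_cons, List.flatten_nil, List.append_nil]
    rw [← List.map_append, List.Ico.append_consecutive (hb (Nat.zero_le c)) (hb (Nat.le_succ c))]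

theorem map_Ico_eq_iff {F : ℕ → ℕ} {x y z w : ℕ} (h : y - x = w - z) :
    (List.Ico x y).map F = List.Ico z w ↔ ∀ r, x ≤ r → r < y → F r = z + (r - x) := by
  constructor
  · intro he r h1 h2
    have hl : r - x < ((List.Ico x y).map F).length := by simp; omega
    have hl' : r - x < (List.Ico z w).length := by simp; omega
    have := List.getElem_of_eq he hl
    simp only [List.getElem_map, List.Ico, List.getElem_range', one_mul] at this
    rwa [show x + (r - x) = r by omega] at this
  · intro hF
    refine List.ext_getElem (by simp [h]) fun j h1 h2 => ?_
    simp only [List.length_map, List.Ico.length] at h1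
    simp only [List.getElem_map, List.Ico, List.getElem_range', one_mul]
    rw [hF _ (by omega) (by omega)]
    omega

/-- The positions 0, ..., d are cut at v = d - b c, and those after v into blocks of the same
lengths as the intervals, so the lists can be compared piece by piece. The initial 0 joins the
vertical interval. -/
theorem map_range_eq_label_iff {d c : ℕ} {b : ℕ → ℕ} (h : IsBlockSeq d (c + 1) b) (f : ℕ → ℕ) :
    (List.range (d + 1)).map f = [0] ++ List.Ico 1 (d - b c) ++ [0] ++
        (List.ofFn fun i : Fin c => List.Ico (d - b (i + 1)) (d - b i)).flatten ↔
      (∀ i < d - b c, f i = i) ∧ f (d - b c) = 0 ∧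
        ∀ k < c, ∀ r, b k ≤ r → r < b (k + 1) →
          f (d - b c + 1 + r) = d - b (k + 1) + (r - b k) := by
  have hbc : b c < d := by
    have := h.lt_succ c (by omega)
    rwa [h.eq_top (c + 1) le_rfl] at this
  obtain ⟨v, hv⟩ : ∃ v, v = d - b c := ⟨_, rfl⟩
  rw [← hv]
  have e1 : List.range (d + 1) = List.Ico 0 v ++ [v] ++ (List.Ico 0 (b c)).map (v + 1 + ·) := by
    rw [List.Ico.map_add, zero_add, ← List.Ico.zero_bot, ← List.Ico.succ_singleton,
      List.Ico.append_consecutive (by omega) (by omega),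
      List.Ico.append_consecutive (by omega) (by omega)]
    congr 1
    omega
  have e2 : [0] ++ List.Ico 1 v = List.Ico 0 v := (List.Ico.eq_cons (by omega)).symm
  have e3 : (List.Ico 0 (b c)).map (fun r => f (v + 1 + r))
      = (List.ofFn fun i : Fin c =>
          (List.Ico (b i) (b (i + 1))).map fun r => f (v + 1 + r)).flatten := by
    rw [flatten_map_Ico (fun r => f (v + 1 + r)) b h.monotone c, h.zero]
  have hblock : ∀ i : ℕ, b (i + 1) - b i = d - b i - (d - b (i + 1)) := fun i => by
    have := h.le_top (i + 1)
    have := h.monotone (show i ≤ i + 1 by omega)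
    omega
  rw [e1, e2, List.map_append, List.map_append, List.map_map]
  change _ ++ _ ++ (List.Ico 0 (b c)).map (fun r => f (v + 1 + r)) = _ ↔ _
  rw [e3]
  constructor
  · intro he
    obtain ⟨h1, h2⟩ := List.append_inj he (by simp)
    obtain ⟨h3, h4⟩ := List.append_inj h1 (by simp)
    refine ⟨fun i hi => ?_, by simpa using h4, fun k hk => ?_⟩
    · have := (map_Ico_eq_iff rfl).1 h3 i (Nat.zero_le i) hi
      omega
    · have h5 := (List.eq_iff_flatten_eq.2 ⟨h2, by
        rw [List.map_ofFn, List.map_ofFn]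
        congr 1
        funext i
        simp [hblock]⟩)
      have h6 := congrFun (List.ofFn_injective h5) ⟨k, hk⟩
      exact (map_Ico_eq_iff (hblock k)).1 h6
  · rintro ⟨h1, h2, h3⟩
    congr 1
    · congr 1
      · exact (map_Ico_eq_iff rfl).2 fun r _ hr => by rw [h1 r hr]; omega
      · simp [h2]
    · congr 2
      funext i
      exact (map_Ico_eq_iff (hblock i)).2 (h3 i i.2)

variable {d c : ℕ} {b : ℕ → ℕ} {P : YoungDiagram}

/-- The `i`-th entry of the branch label of `P`. -/
def branchLength (d : ℕ) (P : YoungDiagram) (i : ℕ) : ℕ :=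
  if i < lastGap d P then P.colLen i - (d - i)
  else if i = lastGap d P then 0
  else P.rowLen (i - lastGap d P - 1) - (d - (i - lastGap d P - 1))

theorem rowLen_le_of_notMem {i j : ℕ} (h : (i, j) ∉ P) : P.rowLen i ≤ j := by
  rwa [YoungDiagram.mem_iff_lt_rowLen, not_lt] at h

theorem lastGap_notMem (h : 0 < lastGap d P) : (d - lastGap d P, lastGap d P) ∉ P :=
  Nat.findGreatest_of_ne_zero (P := fun i => (d - i, i) ∉ P) rfl h.ne'

/-- The last block consists of d - b c rows of length d - b c. Its corner position (b c, d - b c) is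
therefore the last gap on diagonal d, and each column to the left of it has length d. -/
theorem branchLabel_eq_of_rows (h : IsBlockSeq d (c + 1) b)
    (hrow : ∀ k r, b k ≤ r → r < b (k + 1) → P.rowLen r = 2 * d - b k - b (k + 1))
    (hrow0 : ∀ r, d ≤ r → P.rowLen r = 0) :
    (∀ i < d - b c, branchLength d P i = i) ∧ branchLength d P (d - b c) = 0 ∧
        ∀ k < c, ∀ r, b k ≤ r → r < b (k + 1) →
          branchLength d P (d - b c + 1 + r) = d - b (k + 1) + (r - b k) := by
  have htop := h.eq_top (c + 1) le_rfl
  have hbc := h.lt_succ c (by omega)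
  rw [htop] at hbc
  have hlast : ∀ r, b c ≤ r → r < d → P.rowLen r = d - b c := by
    intro r h1 h2
    rw [hrow c r h1 (by omega), htop]
    omega
  have hgap : lastGap d P = d - b c := by
    unfold lastGap
    rw [Nat.findGreatest_eq_iff]
    refine ⟨by omega, fun _ => ?_, fun n h1 h2 => ?_⟩
    · rw [YoungDiagram.mem_iff_lt_rowLen, hlast _ (by omega) (by omega)]
      omega
    · rw [not_not, YoungDiagram.mem_iff_lt_rowLen]
      have hle := blockIndex_le h (d - n)
      have hlt : blockIndex (c + 1) b (d - n) < c := by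
        by_contra! hc
        have := h.monotone hc
        omega
      have hlt' := lt_blockIndex_succ (b := b) (i := d - n) (n := c + 1) (by omega)
      rw [hrow _ _ hle hlt']
      have := h.monotone (show blockIndex (c + 1) b (d - n) + 1 ≤ c by omega)
      omega
  have hcol : ∀ i < d - b c, P.colLen i = d := by
    intro i hi
    have h1 : (d - 1, i) ∈ P := by
      rw [YoungDiagram.mem_iff_lt_rowLen, hlast _ (by omega) (by omega)]
      exact hi
    have h2 : (d, i) ∉ P := by
      rw [YoungDiagram.mem_iff_lt_rowLen, hrow0 d le_rfl]
      omega
    rw [YoungDiagram.mem_iff_lt_colLen] at h1 h2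
    omega
  refine ⟨fun i hi => ?_, ?_, fun k hk r h1 h2 => ?_⟩
  · rw [branchLength, hgap, if_pos hi, hcol i hi]
    omega
  · rw [branchLength, hgap, if_neg (lt_irrefl _), if_pos rfl]
  · rw [branchLength, hgap, if_neg (by omega), if_neg (by omega),
      show d - b c + 1 + r - (d - b c) - 1 = r by omega, hrow k r h1 h2]
    have := h.monotone (show k + 1 ≤ c by omega)
    omega

theorem rows_of_branchLabel_eq (hd : 2 ≤ d) (hP : HasDiagonalLengths P (peak d))
    (h : IsBlockSeq d (c + 1) b) (h1 : ∀ i < d - b c, branchLength d P i = i)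
    (h3 : ∀ k < c, ∀ r, b k ≤ r → r < b (k + 1) →
      branchLength d P (d - b c + 1 + r) = d - b (k + 1) + (r - b k)) :
    (∀ k r, b k ≤ r → r < b (k + 1) → P.rowLen r = 2 * d - b k - b (k + 1)) ∧
      ∀ r, d ≤ r → P.rowLen r = 0 := by
  have htop := h.eq_top (c + 1) le_rfl
  have hbc := h.lt_succ c (by omega)
  rw [htop] at hbc
  have hgle : lastGap d P ≤ d := Nat.findGreatest_le d
  have hgpos : 0 < lastGap d P := by
    obtain ⟨i, hi1, hi2, hi3⟩ := exists_gap hd hP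
    exact lt_of_lt_of_le hi1 (Nat.le_findGreatest (P := fun i => (d - i, i) ∉ P) hi2 hi3)
  have hzero : branchLength d P (lastGap d P) = 0 := by
    rw [branchLength, if_neg (lt_irrefl _), if_pos rfl]
  -- The prescribed label vanishes only at 0 and d - b c, and `lastGap` is a positive index where
  -- the label vanishes.
  have hgap : lastGap d P = d - b c := by
    rcases lt_trichotomy (lastGap d P) (d - b c) with hlt | heq | hgt
    · have := h1 _ hlt
      omega
    · exact heq
    · exfalso
      obtain ⟨r, hr⟩ : ∃ r, lastGap d P = d - b c + 1 + r := ⟨lastGap d P - (d - b c + 1), by omega⟩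
      have hle := blockIndex_le h r
      have hlt : blockIndex (c + 1) b r < c := by
        by_contra! hc
        have := h.monotone hc
        omega
      have hlt' := lt_blockIndex_succ (b := b) (i := r) (n := c + 1) (by omega)
      have := h3 _ hlt r hle hlt'
      rw [← hr, hzero] at this
      have := h.monotone (show blockIndex (c + 1) b r + 1 ≤ c by omega)
      omega
  have hcol : ∀ i < d - b c, P.colLen i - (d - i) = i := fun i hi => by
    have := h1 i hi
    rwa [branchLength, hgap, if_pos hi] at this
  have hrow0 : ∀ r, d ≤ r → P.rowLen r = 0 := by
    intro r hr
    by_contra hne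
    have hmem := YoungDiagram.mem_iff_lt_rowLen.2 (Nat.pos_of_ne_zero hne)
    rw [YoungDiagram.mem_iff_lt_colLen] at hmem
    have := hcol 0 (by omega)
    omega
  refine ⟨fun k r hr1 hr2 => ?_, hrow0⟩
  rcases lt_trichotomy k c with hk | rfl | hk
  -- The prescribed value is positive, so the truncated subtraction in the label determines the row
  -- length.
  · have hf := h3 k hk r hr1 hr2
    have := h.monotone (show k + 1 ≤ c by omega)
    rw [branchLength, hgap, if_neg (by omega), if_neg (by omega),
      show d - b c + 1 + r - (d - b c) - 1 = r by omega] at hf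
    omega
  -- In the last block the gap at (b k, d - b k) bounds the rows above, and the box (d - 1, d - b k
  -- - 1) bounds them below.
  · rw [htop] at hr2 ⊢
    have hup : P.rowLen (b k) ≤ d - b k := by
      have := rowLen_le_of_notMem (lastGap_notMem hgpos)
      rwa [hgap, show d - (d - b k) = b k by omega] at this
    have hanti := P.rowLen_anti (b k) r hr1
    have hlow : (d - 1, d - b k - 1) ∈ P := by
      -- If d - b k = 1, the label of column 0 is 0, which under truncation gives only an upper
      -- bound; the box then comes from the basic triangle.
      rcases Nat.lt_or_ge 1 (d - b k) with hv | hv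
      · rw [YoungDiagram.mem_iff_lt_colLen]
        have := hcol (d - b k - 1) (by omega)
        omega
      · exact mem_of_add_lt hd hP (by omega)
    have hr := YoungDiagram.mem_iff_lt_rowLen.1 (P.up_left_mem (show r ≤ d - 1 by omega) le_rfl hlow)
    omega
  · rw [h.eq_top k hk, h.eq_top (k + 1) (by omega)] at *
    omega

theorem isBlockDiagram_iff_branchLabel (hd : 2 ≤ d) (hP : HasDiagonalLengths P (peak d)) :
    IsBlockDiagram d P ↔ ∃ (c : ℕ) (b : ℕ → ℕ), IsBlockSeq d (c + 1) b ∧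
      branchLabel d P = [0] ++ List.Ico 1 (d - b c) ++ [0] ++
        (List.ofFn fun i : Fin c => List.Ico (d - b (i + 1)) (d - b i)).flatten := by
  constructor
  · rintro ⟨n, b, h, hrow, hrow0⟩
    obtain ⟨c, rfl⟩ : ∃ c, n = c + 1 := ⟨n - 1, by have := h.pos; omega⟩
    exact ⟨c, b, h, (map_range_eq_label_iff h (branchLength d P)).2
      (branchLabel_eq_of_rows h hrow hrow0)⟩
  · rintro ⟨c, b, h, hlab⟩
    obtain ⟨h1, -, h3⟩ := (map_range_eq_label_iff h (branchLength d P)).1 hlab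
    exact ⟨c + 1, b, h, rows_of_branchLabel_eq hd hP h h1 h3⟩

/-- The sequences a and b agree up to c, where v = d - b c, and b continues with the constant d; v ≥
1 is the last strict inequality b c < d. -/
theorem exists_isBlockSeq_iff (l : List ℕ) :
    (∃ (c : ℕ) (b : ℕ → ℕ), IsBlockSeq d (c + 1) b ∧
      l = [0] ++ List.Ico 1 (d - b c) ++ [0] ++
        (List.ofFn fun i : Fin c => List.Ico (d - b (i + 1)) (d - b i)).flatten) ↔
    ∃ v : ℕ, 1 ≤ v ∧ v ≤ d ∧
        ∃ (c : ℕ) (a : Fin (c + 1) → ℕ),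
          StrictMono a ∧ a 0 = 0 ∧ a (Fin.last c) = d - v ∧
            l = [0] ++ List.Ico 1 v ++ [0] ++
                (List.ofFn fun i : Fin c =>
                  List.Ico (d - a i.succ) (d - a i.castSucc)).flatten := by
  constructor
  · rintro ⟨c, b, h, hl⟩
    have hbc := h.lt_succ c (by omega)
    rw [h.eq_top (c + 1) le_rfl] at hbc
    refine ⟨d - b c, by omega, by omega, c, fun i => b i, ?_, h.zero, ?_, hl⟩
    · exact Fin.strictMono_iff_lt_succ.2 fun i => h.lt_succ i (by omega)
    · simp only [Fin.val_last]
      omega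
  · rintro ⟨v, hv1, hv2, c, a, ha, ha0, hac, hl⟩
    let b : ℕ → ℕ := fun k => if h : k < c + 1 then a ⟨k, h⟩ else d
    have hb : ∀ i : Fin (c + 1), b i = a i := fun i => dif_pos i.2
    have hbc : b c = d - v := by rw [← hac, ← hb]; rfl
    refine ⟨c, b, ⟨by omega, ?_, fun k hk => ?_, fun k hk => dif_neg (by omega)⟩, ?_⟩
    · exact (hb 0).trans ha0
    · rcases Nat.lt_or_ge k c with hkc | hkc
      · have := ha (Fin.castSucc_lt_succ (i := ⟨k, hkc⟩))
        rwa [← hb, ← hb] at this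
      · obtain rfl : k = c := by omega
        rw [hbc, show b (k + 1) = d from dif_neg (by omega)]
        omega
    · rw [hl, hbc, show d - (d - v) = v by omega]
      congr 3
      funext i
      rw [← hb, ← hb]
      rfl

end Label

end HeightTwoCI

theorem theorem3p7 (k : Type*) [Field k] [Infinite k] (d : ℕ) (hd : 2 ≤ d)
    (hchar : ringChar k = 0 ∨ 2 * d - 2 < ringChar k)
    (P : YoungDiagram) (hP : HeightTwoCI.HasDiagonalLengths P (HeightTwoCI.peak d)) :
    HeightTwoCI.IsCIJT k P ↔
      ∃ v : ℕ, 1 ≤ v ∧ v ≤ d ∧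
        ∃ (c : ℕ) (a : Fin (c + 1) → ℕ),
          StrictMono a ∧ a 0 = 0 ∧ a (Fin.last c) = d - v ∧
            HeightTwoCI.branchLabel d P =
              [0] ++ List.Ico 1 v ++ [0] ++
                (List.ofFn fun i : Fin c => List.Ico (d - a i.succ) (d - a i.castSucc)).flatten := by
  rw [← HeightTwoCI.exists_isBlockSeq_iff,
    ← HeightTwoCI.isBlockDiagram_iff_branchLabel hd hP]
  exact ⟨HeightTwoCI.isBlockDiagram_of_isCIJT hd hP,
    HeightTwoCI.isCIJT_of_isBlockDiagram k (by omega)⟩
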